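/- Let $M$ be a loopless matroid of rank function $\operatorname{rk}$ on a nonempty finite ground set $E$, with lattice of flats $\mathcal L$, and write $\operatorname{rk} M=\operatorname{rk}(E)$. Let $\mathcal N^\circ(M)$ be the set of flags (chains under inclusion, including the empty one) of nonempty proper flats of $M$. For $\mathcal F\in\mathcal N^\circ(M)$ let $M_{\mathcal F}$ be the matroid on $E$ whose bases are the bases $B$ of $M$ that maximize $\sum_{e\in B}w_e$, where $w=\sum_{F\in\mathcal F}v_F$ and $v_F\in\mathbb R^E$ is the indicator vector of $F$ (any positive combination of the $v_F$, $F \in \mathcal F$, gives the same matroid). For a matroid $N$ on $E$ let $$\overline\chi_N(q)=\frac{1}{q-1}\sum_{S\subseteq E}(-1)^{\#S}q^{\operatorname{rk}N-\operatorname{rk}_N S}\in\mathbb Z[q]$$ be its reduced characteristic polynomial. Let $$D^\bullet(M)=\bigoplus_i D^i(M)=\mathbb Z[x_F : F\in\mathcal L\setminus\{\emptyset\}]/\mathcal I,\qquad \deg x_F=2,$$ where $\mathcal I$ is generated by the products $\prod_{i=1}^k x_{F_i}$ over all sets $\{F_1,\dots,F_k\}$ of nonempty flats that are not chains, and by the sums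 $\sum_{F\supseteq A}x_F$ over all atoms $A$ of $\mathcal L$. Then $(q-1)^{\#\mathcal F}$ divides $\overline\chi_{M_{\mathcal F}}(q)$ in $\mathbb Z[q]$ for every $\mathcal F\in\mathcal N^\circ(M)$, and the polynomial $$\overline P_M(q)=\sum_{\mathcal F\in\mathcal N^\circ(M)}\frac{\overline\chi_{M_{\mathcal F}}(q)}{(q-1)^{\#\mathcal F}}\in\mathbb Z[q]$$ satisfies $$\overline P_M(q^2)=\sum_{i\ge 0}\operatorname{rk}_{\mathbb Z}D^i(M)\,q^i .$$ -/

import Mathlib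

open Polynomial

namespace MatroidHilbert

variable {α : Type*}

/-- The rank `rk_M X` of a set `X`, as a natural number. -/
noncomputable def rk (M : Matroid α) (X : Set α) : ℕ := (M.eRk X).toNat

/-! ### Characteristic polynomials -/

/-- The characteristic polynomial `χ_M(q) = ∑_{S ⊆ E} (-1)^{#S} q^{rk M - rk S}`. -/
noncomputable def charPoly (M : Matroid α) [M.Finite] : ℤ[X] :=
  ∑ S ∈ M.ground_finite.toFinset.powerset,
    (-1) ^ S.card * X ^ (rk M M.E - rk M (S : Set α))

/-- The `q`-analogue `[n]_q = 1 + q + ⋯ + q^{n-1}`. -/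
noncomputable def qAnalogue (n : ℕ) : ℤ[X] := ∑ i ∈ Finset.range n, X ^ i

/-- The reduced characteristic polynomial
`∑_{S ⊆ E} (-1)^{#S} [rk M - rk S]_q`, which equals `χ_M(q) / (q - 1)` for nonempty `E`. -/
noncomputable def reducedCharPoly (M : Matroid α) [M.Finite] : ℤ[X] :=
  ∑ S ∈ M.ground_finite.toFinset.powerset,
    (-1) ^ S.card * qAnalogue (rk M M.E - rk M (S : Set α))

theorem X_sub_one_mul_reducedCharPoly (M : Matroid α) [M.Finite] [M.Nonempty] :
    (X - 1) * reducedCharPoly M = charPoly M := by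
  have h0 : ∑ S ∈ M.ground_finite.toFinset.powerset, ((-1) ^ S.card : ℤ[X]) = 0 := by
    have h := Finset.sum_powerset_neg_one_pow_card_of_nonempty
      (x := M.ground_finite.toFinset) (by simpa using M.ground_nonempty)
    exact_mod_cast congrArg (Int.cast : ℤ → ℤ[X]) h
  have h1 : ∀ n : ℕ, (X - 1 : ℤ[X]) * qAnalogue n = X ^ n - 1 := fun n ↦ by
    rw [qAnalogue, mul_comm, geom_sum_mul]
  calc (X - 1) * reducedCharPoly M
      = ∑ S ∈ M.ground_finite.toFinset.powerset,
          ((-1) ^ S.card * X ^ (rk M M.E - rk M (S : Set α)) - (-1) ^ S.card) := by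
        rw [reducedCharPoly, Finset.mul_sum]
        refine Finset.sum_congr rfl fun S _ ↦ ?_
        rw [mul_left_comm, h1]; ring
    _ = charPoly M := by rw [Finset.sum_sub_distrib, h0, sub_zero, charPoly]

/-! ### Initial matroids -/

/-- The weight `∑_{e ∈ B} w_e` of a set `B`. -/
noncomputable def weight (w : α → ℝ) (B : Set α) : ℝ := ∑ᶠ e ∈ B, w e

/-- `B` is a basis of `M` of maximal weight with respect to `w`. -/
def IsMaxBase (M : Matroid α) (w : α → ℝ) (B : Set α) : Prop :=
  M.IsBase B ∧ ∀ B', M.IsBase B' → weight w B' ≤ weight w B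

theorem exists_symm_exchange {M : Matroid α} {A B : Set α} {e : α} (hA : M.IsBase A)
    (hB : M.IsBase B) (he : e ∈ A \ B) :
    ∃ f ∈ B \ A, M.IsBase (insert f (A \ {e})) ∧ M.IsBase (insert e (B \ {f})) := by
  have heE : e ∈ M.E := hA.subset_ground he.1
  have hC : M.IsCircuit (M.fundCircuit e B) := hB.fundCircuit_isCircuit heE he.2
  have hK : M.IsCocircuit (M.fundCocircuit e A) := M.fundCocircuit_isCocircuit he.1 hA
  have hnt := hC.isCocircuit_inter_nontrivial hK
    ⟨e, M.mem_fundCircuit e B, M.mem_fundCocircuit e A⟩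
  obtain ⟨f, ⟨hfC, hfK⟩, hfe⟩ := hnt.exists_ne e
  have hfB : f ∈ B := ((M.fundCircuit_subset_insert e B) hfC).resolve_left hfe
  have hfA : f ∉ A := by
    have := ((M.fundCocircuit_subset_insert_compl e A) hfK).resolve_left hfe
    exact this.2
  refine ⟨f, ⟨hfB, hfA⟩, ?_, ?_⟩
  · have h2 := (hA.mem_fundCocircuit_iff_mem_fundCircuit (e := f) (f := e)).1 hfK
    have hfE := hB.subset_ground hfB
    have h3 := (hA.indep.mem_fundCircuit_iff (by rwa [hA.closure_eq]) hfA).1 h2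
    refine hA.exchange_isBase_of_indep hfA ?_
    rwa [← Set.insert_sdiff_singleton_comm (by rintro rfl; exact hfA he.1)] at h3
  · have h3 := (hB.indep.mem_fundCircuit_iff (by rwa [hB.closure_eq]) he.2).1 hfC
    refine hB.exchange_isBase_of_indep he.2 ?_
    rwa [← Set.insert_sdiff_singleton_comm (fun h ↦ hfe h.symm)] at h3

theorem weight_exchange (w : α → ℝ) {A : Set α} (hA : A.Finite) {e f : α} (he : e ∈ A)
    (hf : f ∉ A) : weight w (insert f (A \ {e})) = weight w A - w e + w f := by
  have h1 : weight w (insert f (A \ {e})) = w f + weight w (A \ {e}) :=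
    finsum_mem_insert _ (fun h ↦ hf h.1) hA.sdiff
  have h2 : weight w (insert e (A \ {e})) = w e + weight w (A \ {e}) :=
    finsum_mem_insert _ (by simp) hA.sdiff
  rw [Set.insert_sdiff_singleton, Set.insert_eq_of_mem he] at h2
  linarith

theorem exists_isMaxBase (M : Matroid α) [M.Finite] (w : α → ℝ) : ∃ B, IsMaxBase M w B := by
  have hfin : {B | M.IsBase B}.Finite :=
    M.ground_finite.finite_subsets.subset fun B hB ↦ hB.subset_ground
  obtain ⟨B, hB, hmax⟩ := Set.exists_max_image _ (weight w) hfin M.exists_isBase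
  exact ⟨B, hB, hmax⟩

theorem isMaxBase_exchange (M : Matroid α) [M.Finite] (w : α → ℝ) :
    Matroid.ExchangeProperty (IsMaxBase M w) := by
  rintro A B ⟨hA, hAm⟩ ⟨hB, hBm⟩ e he
  obtain ⟨f, hf, h1, h2⟩ := exists_symm_exchange hA hB he
  refine ⟨f, hf, h1, fun B' hB' ↦ (hAm B' hB').trans ?_⟩
  have h3 := hBm _ h2
  rw [weight_exchange w hB.finite hf.1 he.2] at h3
  rw [weight_exchange w hA.finite he.1 hf.2]
  linarith

/-- The matroid `M_w` on the ground set of `M`, whose bases are the bases of `M` of maximal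
`w`-weight. -/
noncomputable def initialMatroid (M : Matroid α) [M.Finite] (w : α → ℝ) : Matroid α :=
  Matroid.ofIsBaseOfFinite M.ground_finite (IsMaxBase M w) (exists_isMaxBase M w)
    (isMaxBase_exchange M w) (fun _ hB ↦ hB.1.subset_ground)

instance initialMatroid_finite (M : Matroid α) [M.Finite] (w : α → ℝ) :
    (initialMatroid M w).Finite := ⟨M.ground_finite⟩

/-! ### Flags of flats -/

/-- The flats of `M` strictly above the minimal flat `cl(∅)`, ordered by inclusion. -/
abbrev NonminFlat (M : Matroid α) : Type _ := {F : Set α // M.IsFlat F ∧ M.closure ∅ ⊂ F}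

instance nonminFlat_finite (M : Matroid α) [M.Finite] : Finite (NonminFlat M) :=
  (M.ground_finite.finite_subsets.subset
    fun _ hF ↦ hF.1.subset_ground : {F | M.IsFlat F ∧ M.closure ∅ ⊂ F}.Finite).to_subtype

noncomputable instance nonminFlat_fintype (M : Matroid α) [M.Finite] : Fintype (NonminFlat M) :=
  Fintype.ofFinite _

/-- Membership in `𝒩(M)`: the finite set `𝓕` of non-minimal flats is a flag. -/
def IsFlag {M : Matroid α} (𝓕 : Finset (NonminFlat M)) : Prop :=
  IsChain (· ≤ ·) (𝓕 : Set (NonminFlat M))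

open Classical in
/-- The set `𝒩°(M)` of flags of non-minimal flats that do not contain the ground set. -/
noncomputable def properFlags (M : Matroid α) [M.Finite] : Finset (Finset (NonminFlat M)) :=
  {𝓕 | IsFlag 𝓕 ∧ ∀ F ∈ 𝓕, F.1 ≠ M.E}

/-- The vector `∑_{F ∈ 𝓕} c_F v_F`, where `v_F` is the indicator vector of `F`. The relative
interior of the cone `σ_𝓕` of a flag `𝓕` consists of these vectors with all `c_F > 0`. -/
noncomputable def flagVector {M : Matroid α} (𝓕 : Finset (NonminFlat M))
    (c : NonminFlat M → ℝ) : α → ℝ :=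
  ∑ F ∈ 𝓕, c F • Set.indicator F.1 (fun _ ↦ (1 : ℝ))

/-- The matroid `M_𝓕`, that is `M_w` for `w` in the relative interior of `σ_𝓕`. The definition
takes `w = ∑_{F ∈ 𝓕} v_F`; see `initialMatroid_flagVector` for the independence of `w`. -/
noncomputable def flagMatroid (M : Matroid α) [M.Finite] (𝓕 : Finset (NonminFlat M)) :
    Matroid α := initialMatroid M (flagVector 𝓕 fun _ ↦ 1)

instance flagMatroid_finite (M : Matroid α) [M.Finite] (𝓕 : Finset (NonminFlat M)) :
    (flagMatroid M 𝓕).Finite := initialMatroid_finite M _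

theorem weight_flagVector {M : Matroid α} (𝓕 : Finset (NonminFlat M)) (c : NonminFlat M → ℝ)
    {B : Set α} (hB : B.Finite) :
    weight (flagVector 𝓕 c) B = ∑ F ∈ 𝓕, c F * ((B ∩ F.1).ncard : ℝ) := by
  classical
  have h : ∀ F : Set α, ((B ∩ F).ncard : ℝ) = ∑ e ∈ hB.toFinset, F.indicator (fun _ ↦ (1 : ℝ)) e := by
    intro F
    rw [Set.ncard_eq_toFinset_card _ (hB.inter_of_left F)]
    simp only [Set.indicator_apply, Finset.sum_boole]
    congr 2
    ext x; simp
  rw [weight, finsum_mem_eq_finite_toFinset_sum _ hB]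
  simp only [flagVector, Finset.sum_apply, Pi.smul_apply, smul_eq_mul, h, Finset.mul_sum]
  exact Finset.sum_comm

theorem ncard_inter_le_rk {M : Matroid α} [M.Finite] {B : Set α} (hB : M.IsBase B) (F : Set α) :
    (B ∩ F).ncard ≤ rk M F := by
  have h := (hB.indep.inter_right F).encard_le_eRk_of_subset Set.inter_subset_right
  exact ENat.toNat_le_toNat h (by simp)

/-- There is a basis of `M` meeting each member of a flag in a set of full rank. -/
theorem exists_isBase_adapted {M : Matroid α} [M.Finite] (𝓕 : Finset (NonminFlat M))
    (h𝓕 : IsFlag 𝓕) : ∃ B, M.IsBase B ∧ ∀ F ∈ 𝓕, (B ∩ F.1).ncard = rk M F.1 := by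
  classical
  suffices h : ∃ I, M.Indep I ∧ (∀ x ∈ I, ∃ F ∈ 𝓕, x ∈ F.1) ∧
      ∀ F ∈ 𝓕, M.IsBasis (I ∩ F.1) F.1 by
    obtain ⟨I, hI, -, h⟩ := h
    obtain ⟨B, hB, hIB⟩ := hI.exists_isBase_superset
    refine ⟨B, hB, fun F hF ↦ le_antisymm (ncard_inter_le_rk hB _) ?_⟩
    rw [rk, ← (h F hF).encard_eq_eRk]
    exact Set.ncard_le_ncard (Set.inter_subset_inter_left _ hIB) (hB.finite.inter_of_left _)
  induction hn : 𝓕.card generalizing 𝓕 with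
  | zero =>
    obtain rfl := Finset.card_eq_zero.1 hn
    exact ⟨∅, M.empty_indep, by simp, by simp⟩
  | succ n ih =>
    have hne : 𝓕.Nonempty := by rw [← Finset.card_pos]; omega
    obtain ⟨G, hG⟩ := 𝓕.exists_maximal hne
    have hle : ∀ F ∈ 𝓕, F ≤ G := fun F hF ↦ by
      rcases h𝓕.total hF hG.prop with h | h
      · exact h
      · exact hG.le_of_ge hF h
    obtain ⟨I, hI, hIF, hb⟩ := ih (𝓕.erase G)
      (h𝓕.mono (by simp)) (by rw [Finset.card_erase_of_mem hG.prop]; omega)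
    have hIG : I ⊆ G.1 := fun x hx ↦ by
      obtain ⟨F, hF, hxF⟩ := hIF x hx
      exact hle F (Finset.mem_of_mem_erase hF) hxF
    obtain ⟨J, hJ, hIJ⟩ := hI.subset_isBasis_of_subset hIG G.2.1.subset_ground
    refine ⟨J, hJ.indep, fun x hx ↦ ⟨G, hG.prop, hJ.subset hx⟩, fun F hF ↦ ?_⟩
    by_cases hFG : F = G
    · subst hFG
      rwa [Set.inter_eq_self_of_subset_left hJ.subset]
    · have hbF := hb F (Finset.mem_erase.2 ⟨hFG, hF⟩)
      have : I ∩ F.1 = J ∩ F.1 := hbF.eq_of_subset_indep (hJ.indep.inter_right _)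
        (Set.inter_subset_inter_left _ hIJ) Set.inter_subset_right
      rwa [← this]

theorem isMaxBase_flagVector_iff {M : Matroid α} [M.Finite] {𝓕 : Finset (NonminFlat M)}
    (h𝓕 : IsFlag 𝓕) {c : NonminFlat M → ℝ} (hc : ∀ F ∈ 𝓕, 0 < c F) {B : Set α} :
    IsMaxBase M (flagVector 𝓕 c) B ↔
      M.IsBase B ∧ ∀ F ∈ 𝓕, (B ∩ F.1).ncard = rk M F.1 := by
  have hle : ∀ B', M.IsBase B' → ∀ F ∈ 𝓕,
      c F * ((B' ∩ F.1).ncard : ℝ) ≤ c F * (rk M F.1 : ℝ) := fun B' hB' F hF ↦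
    mul_le_mul_of_nonneg_left (by exact_mod_cast ncard_inter_le_rk hB' _) (hc F hF).le
  constructor
  · rintro ⟨hB, hmax⟩
    refine ⟨hB, ?_⟩
    obtain ⟨B₀, hB₀, h₀⟩ := exists_isBase_adapted 𝓕 h𝓕
    have h := hmax B₀ hB₀
    rw [weight_flagVector _ _ hB.finite, weight_flagVector _ _ hB₀.finite] at h
    have h' : ∑ F ∈ 𝓕, c F * ((B₀ ∩ F.1).ncard : ℝ) = ∑ F ∈ 𝓕, c F * (rk M F.1 : ℝ) :=
      Finset.sum_congr rfl fun F hF ↦ by rw [h₀ F hF]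
    have heq := (Finset.sum_eq_sum_iff_of_le (hle B hB)).1
      (le_antisymm (Finset.sum_le_sum (hle B hB)) (h'.symm.le.trans h))
    intro F hF
    exact_mod_cast mul_left_cancel₀ (hc F hF).ne' (heq F hF)
  · rintro ⟨hB, hr⟩
    refine ⟨hB, fun B' hB' ↦ ?_⟩
    rw [weight_flagVector _ _ hB.finite, weight_flagVector _ _ hB'.finite]
    refine Finset.sum_le_sum fun F hF ↦ ?_
    rw [hr F hF]
    exact hle B' hB' F hF

/-- `M_w` is the same matroid for all `w` in the relative interior of `σ_𝓕`. -/
theorem initialMatroid_flagVector (M : Matroid α) [M.Finite] {𝓕 : Finset (NonminFlat M)}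
    (h𝓕 : IsFlag 𝓕) {c : NonminFlat M → ℝ} (hc : ∀ F ∈ 𝓕, 0 < c F) :
    initialMatroid M (flagVector 𝓕 c) = flagMatroid M 𝓕 := by
  refine Matroid.ext_isBase rfl fun B _ ↦ ?_
  simp only [flagMatroid, initialMatroid, Matroid.ofIsBaseOfFinite_isBase]
  rw [isMaxBase_flagVector_iff h𝓕 hc, isMaxBase_flagVector_iff h𝓕 (by simp)]

/-! ### The Poincaré polynomial -/

/-- The Poincaré polynomial
`P̄_M(q) = ∑_{𝓕 ∈ 𝒩°(M)} χ̄_{M_𝓕}(q) / (q - 1)^{#𝓕}`. -/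
noncomputable def poincarePoly (M : Matroid α) [M.Finite] : ℤ[X] :=
  ∑ 𝓕 ∈ properFlags M, reducedCharPoly (flagMatroid M 𝓕) /ₘ (X - 1) ^ 𝓕.card

/-! ### The cohomology ring -/

open Classical in
/-- The ideal of `ℤ[x_F]`, with `F` ranging over the non-minimal flats, generated by the products
`∏ x_{F_i}` over the sets `{F_1, …, F_k}` that are not flags, and by the sums `∑_{F ⊇ A} x_F`
for the atoms `A` of the lattice of flats (the minimal elements among the non-minimal flats). -/
noncomputable def cohomologyIdeal (M : Matroid α) [M.Finite] :
    Ideal (MvPolynomial (NonminFlat M) ℤ) :=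
  Ideal.span
    ({p | ∃ S : Finset (NonminFlat M), ¬ IsFlag S ∧ p = ∏ F ∈ S, MvPolynomial.X F} ∪
      {p | ∃ A : NonminFlat M, IsMin A ∧ p = ∑ F with A ≤ F, MvPolynomial.X F})

/-- The cohomology ring `D(M)`. -/
abbrev CohomologyRing (M : Matroid α) [M.Finite] : Type _ :=
  MvPolynomial (NonminFlat M) ℤ ⧸ cohomologyIdeal M

/-- The graded piece `D^i(M)`, where each variable `x_F` has degree `2`. -/
noncomputable def cohomologyPiece (M : Matroid α) [M.Finite] (i : ℕ) :
    Submodule ℤ (CohomologyRing M) :=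
  (MvPolynomial.weightedHomogeneousSubmodule ℤ (fun _ : NonminFlat M ↦ 2) i).map
    (Ideal.Quotient.mkₐ ℤ (cohomologyIdeal M)).toLinearMap

/-- Each graded piece is a finitely generated abelian group, so its rank is finite. -/
instance cohomologyPiece_finite (M : Matroid α) [M.Finite] (i : ℕ) :
    Module.Finite ℤ (cohomologyPiece M i) :=
  Module.Finite.iff_fg.2
    ((MvPolynomial.weightedHomogeneousSubmodule_fg ℤ _ (by simp) i).map _)

end MatroidHilbert

/-! Both sides enumerate the same finite set `standardExponents`: exponent vectors supported on a
flag F_1 < ⋯ < F_k of nonempty flats (E allowed), with 1 ≤ a_i < rk F_i - rk F_{i-1} and F_0 = ∅.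

Polynomial side. The matroid M_𝓕 is the direct sum of the minors of M between consecutive members of
𝓕 ∪ {E} (`rk_flagMatroid_add`), so its characteristic polynomial is a product of #𝓕 + 1 factors,
each divisible by q - 1. This gives the divisibility, and turns the Poincaré polynomial into a sum
over flags ending at E of products of reduced characteristic polynomials of minors. These are Möbius
inverse, in the lattice of flats, to the q-analogues [rk y - rk x]_q (`sum_intervalSum`). Writing
[d]_q = 1 + (q + ⋯ + q^{d-1}), the Möbius inversion telescopes (`flagSum_intervalSum`), leaving the
sum over all flags of ∏ (q + ⋯ + q^{d_i - 1}), which is the generating function of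
`standardExponents`.

Ring side. Pass to h_F = ∑_{G ⊇ F} x_G. The relations become h_A = 0 for atoms and (h_P - h_{P ∨
Q})(h_Q - h_{P ∨ Q}) = 0. They imply h_F h_G^d = h_G^{d+1} for F ≤ G with d = rk G - rk F, and
h_G^{rk G} = 0. Each nonzero rewriting raises the sum of the ranks of the factors, so standard
monomials span (`hProd_mem_span`).

For independence, each standard exponent a defines a functional on polynomials in the h_F, with
value 0 or 1 on monomials: it distributes the factors among the minors cut out by the support of a,
compares their number with that of a in each minor, and tests the dragon Hall–Rado condition there.
Submodularity of the rank shows that the relations are respected (`dragonHallRado_exchange`,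
`hallRadoValue_exchange`). The matrix of these functionals on standard monomials is unitriangular
for the rank sum (`hallRadoValue_self`, `rankSum_lt_of_hallRadoValue_ne_zero`), hence the monomials
are independent over ℤ. -/

set_option linter.unusedSectionVars false

namespace MatroidHilbert

/-! ### The rank function with natural number values -/

section Rank

variable {α : Type*} (M : Matroid α) [M.Finite]

theorem coe_rk (X : Set α) : (rk M X : ℕ∞) = M.eRk X :=
  ENat.natCast_toNat (by simp)

theorem rk_mono {X Y : Set α} (h : X ⊆ Y) : rk M X ≤ rk M Y := by
  exact_mod_cast (coe_rk M X).trans_le ((M.eRk_mono h).trans_eq (coe_rk M Y).symm)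

theorem rk_inter_add_rk_union_le (X Y : Set α) :
    rk M (X ∩ Y) + rk M (X ∪ Y) ≤ rk M X + rk M Y := by
  have h := M.eRk_inter_add_eRk_union_le X Y
  simp only [← coe_rk] at h
  exact_mod_cast h

@[simp]
theorem rk_empty : rk M ∅ = 0 := by simp [rk]

@[simp]
theorem rk_closure (X : Set α) : rk M (M.closure X) = rk M X := by simp [rk]

theorem rk_union_closure_left (X Y : Set α) : rk M (M.closure X ∪ Y) = rk M (X ∪ Y) := by
  simp [rk]

theorem rk_eq_ncard {I : Set α} (hI : M.Indep I) : rk M I = I.ncard := by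
  rw [rk, hI.eRk_eq_encard, Set.ncard_def]

theorem subset_of_rk_le {F X : Set α} (hF : M.IsFlat F) (hFX : F ⊆ X) (hX : X ⊆ M.E)
    (h : rk M X ≤ rk M F) : X ⊆ F := by
  have h' : M.eRk X ≤ M.eRk F := by
    rw [← coe_rk, ← coe_rk]; exact_mod_cast h
  have h2 := (Matroid.eRk_ne_top_iff.1 (show M.eRk X ≠ ⊤ by simp)).subset hFX
    |>.closure_eq_closure_of_subset_of_eRk_ge_eRk hFX h'
  rw [hF.closure] at h2
  rw [h2]
  exact M.subset_closure X

theorem rk_lt_rk {F G : Set α} (hF : M.IsFlat F) (hFG : F ⊂ G) (hG : G ⊆ M.E) :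
    rk M F < rk M G := by
  by_contra! h
  exact hFG.not_subset (subset_of_rk_le M hF hFG.subset hG h)

theorem rk_union_le (X Y : Set α) : rk M (X ∪ Y) ≤ rk M X + rk M Y :=
  (Nat.le_add_left _ _).trans (rk_inter_add_rk_union_le M X Y)

theorem rk_singleton_le (e : α) : rk M {e} ≤ 1 := by
  have h := M.eRk_singleton_le e
  rw [← coe_rk] at h
  exact_mod_cast h

theorem rk_union_eq_of_closure_eq {X Y : Set α} (h : M.closure X = M.closure Y) (Z : Set α) :
    rk M (X ∪ Z) = rk M (Y ∪ Z) := by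
  rw [← rk_union_closure_left, h, rk_union_closure_left]

end Rank

/-! ### Möbius inversion on a finite poset -/

section Moebius

/-- Möbius inversion without a Möbius function. The solution is built along upper sets: the value at
a new minimal element is free and enters none of the sums at the older elements. It serves both for
rank polynomials and for expressing the x_F through the h_F. -/
theorem exists_sum_filter_le_eq {P A : Type*} [Fintype P] [PartialOrder P] [AddCommGroup A]
    (f : P → A) [DecidableLE P] : ∃ b : P → A, ∀ x, ∑ y with x ≤ y, b y = f x := by
  classical
  suffices h : ∀ S : Finset P, (∀ x ∈ S, ∀ y, x ≤ y → y ∈ S) →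
      ∃ b : P → A, ∀ x ∈ S, ∑ y with x ≤ y, b y = f x by
    obtain ⟨b, hb⟩ := h Finset.univ (by simp)
    exact ⟨b, fun x ↦ hb x (Finset.mem_univ _)⟩
  intro S
  induction hn : S.card generalizing S with
  | zero => simp [Finset.card_eq_zero.1 hn]
  | succ n ih =>
    intro hS
    obtain ⟨m, hm⟩ := S.exists_minimal (Finset.card_pos.1 (by omega))
    obtain ⟨b, hb⟩ := ih (S.erase m) (by rw [Finset.card_erase_of_mem hm.prop]; omega)
      (fun x hx y hxy ↦ by
        rw [Finset.mem_erase] at hx ⊢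
        refine ⟨fun h ↦ hx.1 (le_antisymm (h ▸ hxy) (hm.le_of_le hx.2 (h ▸ hxy))), hS x hx.2 y hxy⟩)
    refine ⟨Function.update b m (f m - ∑ y with m < y, b y), fun x hx ↦ ?_⟩
    by_cases hxm : x = m
    · subst hxm
      have h1 : (Finset.univ.filter fun y ↦ x ≤ y) =
          insert x (Finset.univ.filter fun y ↦ x < y) := by
        ext y; simp [le_iff_eq_or_lt, eq_comm]
      rw [h1, Finset.sum_insert (by simp), Function.update_self]
      have h2 : ∀ y ∈ Finset.univ.filter (fun y ↦ x < y),
          Function.update b x (f x - ∑ y with x < y, b y) y = b y := by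
        intro y hy
        rw [Function.update_of_ne]
        rintro rfl
        simp at hy
      rw [Finset.sum_congr rfl h2, sub_add_cancel]
    · rw [← hb x (Finset.mem_erase.2 ⟨hxm, hx⟩)]
      refine Finset.sum_congr rfl fun y hy ↦ ?_
      rw [Function.update_of_ne]
      rintro rfl
      exact hxm (le_antisymm (by simpa using hy) (hm.le_of_le hx (by simpa using hy)))

end Moebius

/-! ### Characteristic polynomials of minors as Möbius inverses -/

section Interval

variable {α : Type*} (M : Matroid α) [M.Finite]

open Classical in
/-- The elements of the ground set in `y \ x`, as a finset. -/
noncomputable def groundDiff (x y : Set α) : Finset α :=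
  M.ground_finite.toFinset.filter (· ∈ y \ x)

theorem mem_groundDiff {x y : Set α} {e : α} :
    e ∈ groundDiff M x y ↔ e ∈ M.E ∧ e ∈ y ∧ e ∉ x := by
  simp [groundDiff]

/-- The sum `∑_{S ⊆ y \ x} (-1)^{#S} g(rk y - rk (x ∪ S))`. -/
noncomputable def intervalSum (g : ℕ → ℤ[X]) (x y : Set α) : ℤ[X] :=
  ∑ S ∈ (groundDiff M x y).powerset, (-1) ^ S.card * g (rk M y - rk M (x ∪ S))

theorem sum_powerset_neg_one_pow_card_eq_ite (A : Finset α) [Decidable (A = ∅)] :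
    ∑ S ∈ A.powerset, ((-1) ^ S.card : ℤ[X]) = if A = ∅ then 1 else 0 := by
  classical
  have h := congrArg (Int.cast : ℤ → ℤ[X]) (Finset.sum_powerset_neg_one_pow_card (x := A))
  split_ifs with hA
  · simp [hA]
  · simpa [hA] using h

theorem X_sub_one_mul_qAnalogue (n : ℕ) : (X - 1 : ℤ[X]) * qAnalogue n = X ^ n - 1 := by
  rw [qAnalogue, mul_comm, geom_sum_mul]

theorem X_sub_one_mul_intervalSum {x y : Set α} (hxy : x ⊂ y) (hy : y ⊆ M.E) :
    (X - 1) * intervalSum M qAnalogue x y = intervalSum M (fun n ↦ X ^ n) x y := by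
  classical
  obtain ⟨e, hey, hex⟩ := Set.exists_of_ssubset hxy
  have h0 := sum_powerset_neg_one_pow_card_eq_ite (groundDiff M x y)
  rw [if_neg (Finset.ne_empty_of_mem ((mem_groundDiff M).2 ⟨hy hey, hey, hex⟩))] at h0
  simp only [intervalSum, Finset.mul_sum]
  rw [← sub_zero (∑ S ∈ (groundDiff M x y).powerset, _ * X ^ _), ← h0, ← Finset.sum_sub_distrib]
  refine Finset.sum_congr rfl fun S _ ↦ ?_
  rw [mul_left_comm, X_sub_one_mul_qAnalogue]; ring

instance flatsBelow_finite (y : Set α) : Finite {F : Set α // M.IsFlat F ∧ F ⊆ y} :=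
  (M.ground_finite.finite_subsets.subset
    fun _ hF ↦ hF.1.subset_ground : {F | M.IsFlat F ∧ F ⊆ y}.Finite).to_subtype

noncomputable instance flatsBelow_fintype (y : Set α) :
    Fintype {F : Set α // M.IsFlat F ∧ F ⊆ y} := Fintype.ofFinite _

open Classical in
-- The alternating sum over subsets performs the Möbius inversion. Let b be the Möbius inverse of x
-- ↦ g(rk y - rk x). Then g(rk y - rk (x ∪ S)) is the sum of b over the flats G containing x ∪ S;
-- after exchanging sums, the signs over S ⊆ G \ x cancel unless G = x, so `intervalSum M g x y` is
-- b x.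
theorem sum_intervalSum (g : ℕ → ℤ[X]) {y : Set α} (hy : M.IsFlat y)
    (z : {F : Set α // M.IsFlat F ∧ F ⊆ y}) :
    ∑ x with z ≤ x, intervalSum M g x.1 y = g (rk M y - rk M z.1) := by
  obtain ⟨b, hb⟩ := exists_sum_filter_le_eq
    (fun x : {F : Set α // M.IsFlat F ∧ F ⊆ y} ↦ g (rk M y - rk M x.1))
  rw [← hb z]
  refine Finset.sum_congr rfl fun x _ ↦ ?_
  have h1 : ∀ S ∈ (groundDiff M x.1 y).powerset, g (rk M y - rk M (x.1 ∪ S)) =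
      ∑ G with x ≤ G, if (S : Set α) ⊆ G.1 then b G else 0 := by
    intro S hS
    have hSy : (S : Set α) ⊆ y := fun e he ↦
      ((mem_groundDiff M).1 (Finset.mem_powerset.1 hS he)).2.1
    have hxS : x.1 ∪ S ⊆ y := Set.union_subset x.2.2 hSy
    have hcl : M.closure (x.1 ∪ S) ⊆ y := by
      conv_rhs => rw [← hy.closure]
      exact M.closure_subset_closure hxS
    have h := hb ⟨M.closure (x.1 ∪ S), M.isFlat_closure _, hcl⟩
    simp only [rk_closure] at h
    rw [← h, ← Finset.sum_filter, Finset.filter_filter]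
    refine Finset.sum_congr ?_ fun _ _ ↦ rfl
    ext G
    simp only [Finset.mem_filter, Finset.mem_univ, true_and, ← Subtype.coe_le_coe]
    rw [← Set.union_subset_iff]
    refine ⟨fun h ↦ (M.subset_closure _ (hxS.trans hy.subset_ground)).trans h, fun h ↦ ?_⟩
    rw [← G.2.1.closure]
    exact M.closure_subset_closure h
  rw [intervalSum]
  calc _ = ∑ S ∈ (groundDiff M x.1 y).powerset, ∑ G with x ≤ G,
        (-1) ^ S.card * (if (S : Set α) ⊆ G.1 then b G else 0) :=
        Finset.sum_congr rfl fun S hS ↦ by rw [h1 S hS, Finset.mul_sum]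
    _ = ∑ G with x ≤ G, (if G = x then b G else 0) := by
        rw [Finset.sum_comm]
        refine Finset.sum_congr rfl fun G hG ↦ ?_
        have hxG : x ≤ G := by simpa using hG
        have h2 : (groundDiff M x.1 y).powerset.filter (fun S : Finset α ↦ (S : Set α) ⊆ G.1) =
            (groundDiff M x.1 G.1).powerset := by
          ext S
          simp only [Finset.mem_filter, Finset.mem_powerset, Finset.subset_iff, mem_groundDiff,
            Set.subset_def, Finset.mem_coe]
          exact ⟨fun h e he ↦ ⟨(h.1 he).1, h.2 e he, (h.1 he).2.2⟩,
            fun h ↦ ⟨fun e he ↦ ⟨(h he).1, G.2.2 (h he).2.1, (h he).2.2⟩, fun e he ↦ (h he).2.1⟩⟩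
        have h3 : groundDiff M x.1 G.1 = ∅ ↔ G = x := by
          constructor
          · intro h
            refine le_antisymm (fun e he ↦ ?_) hxG
            by_contra hex
            exact Finset.notMem_empty e
              (h ▸ (mem_groundDiff M).2 ⟨G.2.1.subset_ground he, he, hex⟩)
          · rintro rfl
            ext e; simp only [mem_groundDiff, Finset.notMem_empty, iff_false]; tauto
        simp only [mul_ite, mul_zero]
        rw [← Finset.sum_filter, h2, ← Finset.sum_mul, sum_powerset_neg_one_pow_card_eq_ite]
        simp only [h3]
        split_ifs <;> simp
    _ = b x := by
        rw [Finset.sum_ite_eq' _ x b]; simp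

end Interval

/-! ### M_𝓕 as a direct sum of minors -/

section FlagMatroid

variable {α : Type*} {M : Matroid α}

/-- The union of the members of `𝓖` strictly below `F`; for a flag `𝓖` it is the predecessor of
`F` in `𝓖`, or empty if there is none. -/
def flagPred (𝓖 : Finset (NonminFlat M)) (F : NonminFlat M) : Set α :=
  ⋃ G ∈ 𝓖, ⋃ _ : G < F, G.1

theorem mem_flagPred {𝓖 : Finset (NonminFlat M)} {F : NonminFlat M} {e : α} :
    e ∈ flagPred 𝓖 F ↔ ∃ G ∈ 𝓖, G < F ∧ e ∈ G.1 := by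
  simp only [flagPred, Set.mem_iUnion, exists_prop]

theorem flagPred_subset (𝓖 : Finset (NonminFlat M)) (F : NonminFlat M) :
    flagPred 𝓖 F ⊆ F.1 := fun e he ↦ by
  obtain ⟨G, -, hGF, he⟩ := mem_flagPred.1 he
  exact hGF.le he

theorem subset_flagPred {𝓖 : Finset (NonminFlat M)} {F G : NonminFlat M} (hG : G ∈ 𝓖)
    (h : G < F) : G.1 ⊆ flagPred 𝓖 F := fun _ he ↦ mem_flagPred.2 ⟨G, hG, h, he⟩

theorem IsFlag.flagPred_eq {𝓖 : Finset (NonminFlat M)} (h𝓖 : IsFlag 𝓖) (F : NonminFlat M) :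
    flagPred 𝓖 F = ∅ ∨ ∃ G ∈ 𝓖, G < F ∧ flagPred 𝓖 F = G.1 := by
  classical
  by_cases hne : (𝓖.filter (· < F)).Nonempty
  · right
    obtain ⟨G, hG⟩ := Finset.exists_maximal hne
    have hG' := Finset.mem_filter.1 hG.prop
    refine ⟨G, hG'.1, hG'.2, (subset_flagPred hG'.1 hG'.2).antisymm' fun e he ↦ ?_⟩
    obtain ⟨H, hH, hHF, he⟩ := mem_flagPred.1 he
    rcases h𝓖.total hH hG'.1 with h | h
    · exact h he
    · exact hG.le_of_ge (Finset.mem_filter.2 ⟨hH, hHF⟩) h he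
  · left
    refine Set.eq_empty_iff_forall_notMem.2 fun e he ↦ hne ?_
    obtain ⟨H, hH, hHF, he⟩ := mem_flagPred.1 he
    exact ⟨H, Finset.mem_filter.2 ⟨hH, hHF⟩⟩

theorem IsFlag.flagPred_ssubset {𝓖 : Finset (NonminFlat M)} (h𝓖 : IsFlag 𝓖)
    (F : NonminFlat M) : flagPred 𝓖 F ⊂ F.1 := by
  rcases h𝓖.flagPred_eq F with h | ⟨G, -, hGF, h⟩
  · rw [h]
    exact (Set.empty_subset _).trans_ssubset F.2.2
  · rw [h]; exact hGF

variable (M) in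
/-- The ground set, as a non-minimal flat. -/
def topFlat [M.RankPos] : NonminFlat M :=
  ⟨M.E, M.ground_isFlat, (M.closure_subset_ground ∅).ssubset_of_ne fun h ↦ by
    have h2 := M.empty_not_isBase
    rw [Matroid.isBase_iff_indep_closure_eq] at h2
    exact h2 ⟨M.empty_indep, h⟩⟩

theorem le_topFlat [M.RankPos] (F : NonminFlat M) : F ≤ topFlat M := F.2.1.subset_ground

open Classical in
theorem IsFlag.insert_topFlat [M.RankPos] {𝓕 : Finset (NonminFlat M)} (h : IsFlag 𝓕) :
    IsFlag (insert (topFlat M) 𝓕) := by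
  rw [IsFlag, Finset.coe_insert]
  exact h.insert fun F _ _ ↦ Or.inr (le_topFlat F)

variable [M.Finite]

theorem disjoint_groundDiff_flagPred {𝓖 : Finset (NonminFlat M)} (h𝓖 : IsFlag 𝓖) :
    (𝓖 : Set (NonminFlat M)).PairwiseDisjoint fun F ↦ groundDiff M (flagPred 𝓖 F) F.1 := by
  intro F hF G hG hne
  refine Finset.disjoint_left.2 fun e heF heG ↦ ?_
  rw [mem_groundDiff] at heF heG
  rcases h𝓖.total hF hG with h | h
  · exact heG.2.2 (mem_flagPred.2 ⟨F, hF, lt_of_le_of_ne h hne, heF.2.1⟩)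
  · exact heF.2.2 (mem_flagPred.2 ⟨G, hG, lt_of_le_of_ne h hne.symm, heG.2.1⟩)

open Classical in
theorem biUnion_groundDiff_flagPred [M.RankPos] {𝓖 : Finset (NonminFlat M)}
    (hE : topFlat M ∈ 𝓖) :
    (𝓖.biUnion fun F ↦ groundDiff M (flagPred 𝓖 F) F.1) = M.ground_finite.toFinset := by
  ext e
  simp only [Finset.mem_biUnion, mem_groundDiff, Set.Finite.mem_toFinset]
  refine ⟨fun ⟨F, _, h, _⟩ ↦ h, fun he ↦ ?_⟩
  obtain ⟨F, hF⟩ := Finset.exists_minimal (s := 𝓖.filter (e ∈ ·.1))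
    ⟨topFlat M, Finset.mem_filter.2 ⟨hE, he⟩⟩
  have hF' := Finset.mem_filter.1 hF.prop
  refine ⟨F, hF'.1, he, hF'.2, fun h ↦ ?_⟩
  obtain ⟨G, hG, hGF, heG⟩ := mem_flagPred.1 h
  exact hF.not_lt (Finset.mem_filter.2 ⟨hG, heG⟩) hGF

open Classical in
theorem card_eq_sum_card_inter_groundDiff [M.RankPos] {𝓖 : Finset (NonminFlat M)}
    (h𝓖 : IsFlag 𝓖) (hE : topFlat M ∈ 𝓖) {A : Finset α} (hA : (A : Set α) ⊆ M.E) :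
    A.card = ∑ F ∈ 𝓖, (A ∩ groundDiff M (flagPred 𝓖 F) F.1).card := by
  rw [← Finset.card_biUnion, ← Finset.inter_biUnion, biUnion_groundDiff_flagPred hE,
    Finset.inter_eq_left.2]
  · intro e he; simpa using hA he
  · intro F hF G hG hne
    exact ((disjoint_groundDiff_flagPred h𝓖) hF hG hne).mono Finset.inter_subset_right
      Finset.inter_subset_right

/-- There is a basis of `M` meeting each member of a chain of sets in a set of full rank. -/
theorem exists_isBase_adapted_sets (𝒞 : Finset (Set α))
    (h𝒞 : IsChain (· ⊆ ·) (𝒞 : Set (Set α))) (hE : ∀ C ∈ 𝒞, C ⊆ M.E) :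
    ∃ B, M.IsBase B ∧ ∀ C ∈ 𝒞, (B ∩ C).ncard = rk M C := by
  classical
  suffices h : ∃ I, M.Indep I ∧ (∀ x ∈ I, ∃ F ∈ 𝒞, x ∈ F) ∧ ∀ F ∈ 𝒞, M.IsBasis (I ∩ F) F by
    obtain ⟨I, hI, -, h⟩ := h
    obtain ⟨B, hB, hIB⟩ := hI.exists_isBase_superset
    refine ⟨B, hB, fun F hF ↦ le_antisymm (ncard_inter_le_rk hB _) ?_⟩
    rw [rk, ← (h F hF).encard_eq_eRk]
    exact Set.ncard_le_ncard (Set.inter_subset_inter_left _ hIB) (hB.finite.inter_of_left _)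
  induction hn : 𝒞.card generalizing 𝒞 with
  | zero =>
    obtain rfl := Finset.card_eq_zero.1 hn
    exact ⟨∅, M.empty_indep, by simp, by simp⟩
  | succ n ih =>
    have hne : 𝒞.Nonempty := by rw [← Finset.card_pos]; omega
    obtain ⟨G, hG⟩ := 𝒞.exists_maximal hne
    have hle : ∀ F ∈ 𝒞, F ⊆ G := fun F hF ↦ by
      rcases h𝒞.total hF hG.prop with h | h
      · exact h
      · exact hG.le_of_ge hF h
    obtain ⟨I, hI, hIF, hb⟩ := ih (𝒞.erase G) (h𝒞.mono (by simp))
      (fun C hC ↦ hE C (Finset.mem_of_mem_erase hC))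
      (by rw [Finset.card_erase_of_mem hG.prop]; omega)
    have hIG : I ⊆ G := fun x hx ↦ by
      obtain ⟨F, hF, hxF⟩ := hIF x hx
      exact hle F (Finset.mem_of_mem_erase hF) hxF
    obtain ⟨J, hJ, hIJ⟩ := hI.subset_isBasis_of_subset hIG (hE G hG.prop)
    refine ⟨J, hJ.indep, fun x hx ↦ ⟨G, hG.prop, hJ.subset hx⟩, fun F hF ↦ ?_⟩
    by_cases hFG : F = G
    · subst hFG
      rwa [Set.inter_eq_self_of_subset_left hJ.subset]
    · have hbF := hb F (Finset.mem_erase.2 ⟨hFG, hF⟩)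
      have : I ∩ F = J ∩ F := hbF.eq_of_subset_indep (hJ.indep.inter_right _)
        (Set.inter_subset_inter_left _ hIJ) Set.inter_subset_right
      rwa [← this]

theorem flagMatroid_isBase_iff {𝓕 : Finset (NonminFlat M)} (h𝓕 : IsFlag 𝓕) {B : Set α} :
    (flagMatroid M 𝓕).IsBase B ↔ M.IsBase B ∧ ∀ F ∈ 𝓕, (B ∩ F.1).ncard = rk M F.1 := by
  simp only [flagMatroid, initialMatroid, Matroid.ofIsBaseOfFinite_isBase]
  exact isMaxBase_flagVector_iff h𝓕 (by simp)

@[simp]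
theorem flagMatroid_ground (𝓕 : Finset (NonminFlat M)) : (flagMatroid M 𝓕).E = M.E := rfl

theorem ncard_union_inter {B P D : Set α} (hB : B.Finite) (hd : Disjoint P D) :
    (B ∩ (P ∪ D)).ncard = (B ∩ P).ncard + (B ∩ D).ncard := by
  rw [Set.inter_union_distrib_left, Set.ncard_union_eq _ (hB.inter_of_left _) (hB.inter_of_left _)]
  exact hd.mono Set.inter_subset_right Set.inter_subset_right

open Classical in
/-- The rank function of `M_𝓕` is the sum of the rank functions of the minors of `M` between
consecutive members of the flag. -/
theorem rk_flagMatroid_add [M.RankPos] {𝓕 : Finset (NonminFlat M)} (h𝓕 : IsFlag 𝓕)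
    {S : Finset α} (hS : (S : Set α) ⊆ M.E) :
    rk (flagMatroid M 𝓕) S + ∑ F ∈ insert (topFlat M) 𝓕,
        rk M (flagPred (insert (topFlat M) 𝓕) F) =
      ∑ F ∈ insert (topFlat M) 𝓕, rk M (flagPred (insert (topFlat M) 𝓕) F ∪
        ↑(S ∩ groundDiff M (flagPred (insert (topFlat M) 𝓕) F) F.1)) := by
  set 𝓖 := insert (topFlat M) 𝓕 with h𝓖def
  have h𝓖 : IsFlag 𝓖 := h𝓕.insert_topFlat
  have hE : topFlat M ∈ 𝓖 := Finset.mem_insert_self _ _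
  set D : NonminFlat M → Finset α := fun F ↦ groundDiff M (flagPred 𝓖 F) F.1 with hD
  have hDF : ∀ F, (D F : Set α) ⊆ F.1 := fun F e he ↦ ((mem_groundDiff M).1 he).2.1
  have hdisj : ∀ F (A : Finset α), Disjoint (flagPred 𝓖 F) (↑(A ∩ D F) : Set α) := fun F A ↦
    Set.disjoint_left.2 fun e he he' ↦
      ((mem_groundDiff M).1 (Finset.mem_inter.1 (Finset.mem_coe.1 he')).2).2.2 he
  have hfull : ∀ B, M.IsBase B → (∀ F ∈ 𝓕, (B ∩ F.1).ncard = rk M F.1) →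
      ∀ F, (B ∩ flagPred 𝓖 F).ncard = rk M (flagPred 𝓖 F) := by
    intro B hB hBF F
    rcases h𝓖.flagPred_eq F with h | ⟨G, hG, hGF, h⟩
    · rw [h]; simp
    · rw [h]
      rcases Finset.mem_insert.1 hG with rfl | hG
      · exact absurd hGF (not_lt_of_ge (le_topFlat F))
      · exact hBF G hG
  apply le_antisymm
  -- A basis of M_𝓕 already fills each predecessor flat, so its part in the next block is bounded by
  -- the rank gained there.
  · obtain ⟨I, hI⟩ := (flagMatroid M 𝓕).exists_isBasis (S : Set α) hS
    obtain ⟨B, hB, hIB⟩ := hI.indep.exists_isBase_superset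
    rw [flagMatroid_isBase_iff h𝓕] at hB
    have hIfin : I.Finite := hB.1.finite.subset hIB
    lift I to Finset α using hIfin
    have hIS : I ⊆ S := Finset.coe_subset.1 hI.subset
    have h1 : rk (flagMatroid M 𝓕) S = I.card := by
      rw [rk, hI.eRk_eq_encard, Set.encard_coe_eq_coe_finsetCard]; rfl
    rw [h1, card_eq_sum_card_inter_groundDiff h𝓖 hE (hI.subset.trans hS),
      ← Finset.sum_add_distrib]
    refine Finset.sum_le_sum fun F _ ↦ ?_
    have h2 := ncard_inter_le_rk hB.1 (flagPred 𝓖 F ∪ ↑(S ∩ D F))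
    rw [ncard_union_inter hB.1.finite (hdisj F S), hfull B hB.1 hB.2] at h2
    have h3 : (I ∩ D F).card ≤ (B ∩ ↑(S ∩ D F)).ncard := by
      rw [← Set.ncard_coe_finset]
      refine Set.ncard_le_ncard (fun e he ↦ ?_) (hB.1.finite.inter_of_left _)
      have he := Finset.mem_inter.1 (Finset.mem_coe.1 he)
      exact ⟨hIB he.1, Finset.mem_coe.2 (Finset.mem_inter.2 ⟨hIS he.1, he.2⟩)⟩
    change (I ∩ D F).card + _ ≤ rk M (flagPred 𝓖 F ∪ ↑(S ∩ D F))
    omega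
  -- Inserting the predecessor of F together with S ∩ (F minus predecessor) below each F refines the
  -- flag to a longer chain. A basis adapted to this chain is a basis of M_𝓕 and attains the bound
  -- in all blocks simultaneously.
  · obtain ⟨B, hB, hBC⟩ := exists_isBase_adapted_sets (M := M)
      (𝓖.image (fun F ↦ F.1) ∪ 𝓖.image fun F ↦ flagPred 𝓖 F ∪ ↑(S ∩ D F)) (by
        have key : ∀ F ∈ 𝓖, ∀ G ∈ 𝓖, F < G → F.1 ⊆ flagPred 𝓖 G := fun F hF G _ h ↦
          subset_flagPred hF h
        have hsub : ∀ F, flagPred 𝓖 F ∪ ↑(S ∩ D F) ⊆ F.1 := fun F ↦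
          Set.union_subset (flagPred_subset 𝓖 F)
            ((Finset.coe_subset.2 Finset.inter_subset_right).trans (hDF F))
        intro A hA B hB _
        simp only [Finset.coe_union, Finset.coe_image, Set.mem_union, Set.mem_image,
          Finset.mem_coe] at hA hB
        rcases hA with ⟨F, hF, rfl⟩ | ⟨F, hF, rfl⟩ <;> rcases hB with ⟨G, hG, rfl⟩ | ⟨G, hG, rfl⟩
        · exact h𝓖.total hF hG
        · rcases h𝓖.total hF hG with h | h
          · rcases h.eq_or_lt with rfl | h
            · exact Or.inr (hsub F)
            · exact Or.inl ((key F hF G hG h).trans Set.subset_union_left)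
          · exact Or.inr ((hsub G).trans h)
        · rcases h𝓖.total hF hG with h | h
          · exact Or.inl ((hsub F).trans h)
          · rcases h.eq_or_lt with rfl | h
            · exact Or.inl (hsub _)
            · exact Or.inr ((key G hG F hF h).trans Set.subset_union_left)
        · rcases h𝓖.total hF hG with h | h
          · rcases h.eq_or_lt with rfl | h
            · exact Or.inl subset_rfl
            · exact Or.inl ((hsub F).trans ((key F hF G hG h).trans Set.subset_union_left))
          · rcases h.eq_or_lt with rfl | h
            · exact Or.inl subset_rfl
            · exact Or.inr ((hsub G).trans ((key G hG F hF h).trans Set.subset_union_left)))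
      (by
        intro C hC
        simp only [Finset.mem_union, Finset.mem_image] at hC
        rcases hC with ⟨F, hF, rfl⟩ | ⟨F, hF, rfl⟩
        · exact F.2.1.subset_ground
        · exact (Set.union_subset (flagPred_subset 𝓖 F)
            ((Finset.coe_subset.2 Finset.inter_subset_right).trans (hDF F))).trans
            F.2.1.subset_ground)
    have hBF : ∀ F ∈ 𝓕, (B ∩ F.1).ncard = rk M F.1 := fun F hF ↦
      hBC _ (Finset.mem_union_left _ (Finset.mem_image_of_mem _ (Finset.mem_insert_of_mem hF)))
    have hN : (flagMatroid M 𝓕).IsBase B := (flagMatroid_isBase_iff h𝓕).2 ⟨hB, hBF⟩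
    have h1 := ncard_inter_le_rk hN (S : Set α)
    have hBfin := hB.finite
    lift B to Finset α using hBfin
    rw [← Finset.coe_inter, Set.ncard_coe_finset, card_eq_sum_card_inter_groundDiff h𝓖 hE
      (((Finset.coe_subset.2 Finset.inter_subset_right)).trans hS)] at h1
    refine le_trans (le_of_eq ?_) (Nat.add_le_add_right h1 _)
    rw [← Finset.sum_add_distrib]
    refine Finset.sum_congr rfl fun F hF ↦ ?_
    have h2 := hBC _ (Finset.mem_union_right _ (Finset.mem_image_of_mem
      (fun F ↦ flagPred 𝓖 F ∪ (↑(S ∩ D F) : Set α)) hF))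
    rw [← h2, ncard_union_inter hB.finite (hdisj F S), hfull _ hB hBF, add_comm,
      ← Finset.coe_inter, Set.ncard_coe_finset, Finset.inter_assoc]

/-- A sum over the subsets of a disjoint union of a product of functions of the pieces is the
product of the sums over the pieces. -/
theorem sum_powerset_biUnion_prod {ι R : Type*} [CommSemiring R] [DecidableEq α] [DecidableEq ι]
    (s : Finset ι) (D : ι → Finset α) (hD : (s : Set ι).PairwiseDisjoint D)
    (f : ι → Finset α → R) :
    ∑ S ∈ (s.biUnion D).powerset, ∏ i ∈ s, f i (S ∩ D i) =
      ∏ i ∈ s, ∑ S ∈ (D i).powerset, f i S := by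
  induction s using Finset.induction_on with
  | empty => simp
  | insert a s ha ih =>
    rw [Finset.prod_insert ha, ← ih (hD.subset (by simp)), Finset.sum_mul_sum,
      ← Finset.sum_product', Finset.biUnion_insert]
    have hda : Disjoint (D a) (s.biUnion D) := by
      rw [Finset.disjoint_biUnion_right]
      intro i hi
      exact hD (by simp) (by simp [hi]) (by rintro rfl; exact ha hi)
    refine Finset.sum_bij' (fun S _ ↦ (S ∩ D a, S ∩ s.biUnion D)) (fun p _ ↦ p.1 ∪ p.2)
      ?_ ?_ ?_ ?_ ?_
    · intro S _
      simp [Finset.inter_subset_right]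
    · rintro ⟨p, q⟩ h
      simp only [Finset.mem_product, Finset.mem_powerset] at h ⊢
      exact Finset.union_subset_union h.1 h.2
    · intro S hS
      simp only
      rw [← Finset.inter_union_distrib_left, Finset.inter_eq_left]
      exact Finset.mem_powerset.1 hS
    · rintro ⟨p, q⟩ h
      simp only [Finset.mem_product, Finset.mem_powerset] at h
      have h1 : q ∩ D a = ∅ := Finset.disjoint_iff_inter_eq_empty.1
        (Finset.disjoint_of_subset_left h.2 hda.symm)
      have h2 : p ∩ s.biUnion D = ∅ := Finset.disjoint_iff_inter_eq_empty.1
        (Finset.disjoint_of_subset_left h.1 hda)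
      simp only [Finset.union_inter_distrib_right, h1, h2, Finset.empty_union, Finset.union_empty,
        Finset.inter_eq_left.2 h.1, Finset.inter_eq_left.2 h.2]
    · intro S hS
      rw [Finset.prod_insert ha]
      congr 1
      refine Finset.prod_congr rfl fun i hi ↦ ?_
      rw [Finset.inter_assoc, Finset.inter_eq_right.2 (Finset.subset_biUnion_of_mem D hi)]

open Classical in
-- Subsets of E split uniquely over the successive differences of the flag; cardinality and corank
-- in M_𝓕 are additive for this splitting, so the sum over subsets factors.
theorem charPoly_flagMatroid [M.RankPos] {𝓕 : Finset (NonminFlat M)} (h𝓕 : IsFlag 𝓕) :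
    charPoly (flagMatroid M 𝓕) = ∏ F ∈ insert (topFlat M) 𝓕,
      intervalSum M (fun n ↦ X ^ n) (flagPred (insert (topFlat M) 𝓕) F) F.1 := by
  set 𝓖 := insert (topFlat M) 𝓕 with h𝓖def
  have h𝓖 : IsFlag 𝓖 := h𝓕.insert_topFlat
  have hE : topFlat M ∈ 𝓖 := Finset.mem_insert_self _ _
  simp only [intervalSum]
  rw [← sum_powerset_biUnion_prod 𝓖 (fun F ↦ groundDiff M (flagPred 𝓖 F) F.1)
    (disjoint_groundDiff_flagPred h𝓖)
    (fun F S ↦ (-1) ^ S.card * X ^ (rk M F.1 - rk M (flagPred 𝓖 F ∪ S))),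
    biUnion_groundDiff_flagPred hE, charPoly]
  refine Finset.sum_congr rfl fun S hS ↦ ?_
  have hSE : (S : Set α) ⊆ M.E := fun e he ↦ by
    simpa using Finset.mem_powerset.1 hS he
  rw [Finset.prod_mul_distrib, Finset.prod_pow_eq_pow_sum, Finset.prod_pow_eq_pow_sum,
    ← card_eq_sum_card_inter_groundDiff h𝓖 hE hSE]
  congr 2
  -- The rank formula is used for S and for E; the ranks of the predecessors cancel in the
  -- difference. `h5` ensures that no truncated subtraction loses anything.
  have h1 := rk_flagMatroid_add h𝓕 hSE
  have h2 := rk_flagMatroid_add (M := M) h𝓕 (S := M.ground_finite.toFinset) (by simp)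
  have h3 : ∀ F, flagPred 𝓖 F ∪ (groundDiff M (flagPred 𝓖 F) F.1 : Set α) = F.1 := by
    intro F
    ext e
    simp only [Set.mem_union, Finset.mem_coe, mem_groundDiff]
    constructor
    · rintro (h | h)
      exacts [flagPred_subset _ _ h, h.2.1]
    · intro h
      by_cases hp : e ∈ flagPred 𝓖 F
      exacts [Or.inl hp, Or.inr ⟨F.2.1.subset_ground h, h, hp⟩]
  have h4 : ∀ F, M.ground_finite.toFinset ∩ groundDiff M (flagPred 𝓖 F) F.1 =
      groundDiff M (flagPred 𝓖 F) F.1 := fun F ↦ Finset.inter_eq_right.2 (Finset.filter_subset _ _)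
  simp only [← h𝓖def, h4, h3, Set.Finite.coe_toFinset] at h1 h2
  have h5 : ∑ F ∈ 𝓖, (rk M F.1 - rk M (flagPred 𝓖 F ∪
        ↑(S ∩ groundDiff M (flagPred 𝓖 F) F.1))) + ∑ F ∈ 𝓖, rk M (flagPred 𝓖 F ∪
        ↑(S ∩ groundDiff M (flagPred 𝓖 F) F.1)) = ∑ F ∈ 𝓖, rk M F.1 := by
    rw [← Finset.sum_add_distrib]
    refine Finset.sum_congr rfl fun F _ ↦ Nat.sub_add_cancel (rk_mono M ?_)
    conv_rhs => rw [← h3 F]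
    exact Set.union_subset_union_right _ (Finset.coe_subset.2 Finset.inter_subset_right)
  rw [flagMatroid_ground]
  omega

open Classical in
-- Adding E to a proper flag gives #𝓕 + 1 factors, each contributing one q - 1. One of them is
-- absorbed by passing to the reduced polynomial; the others make up the displayed power.
theorem reducedCharPoly_flagMatroid [M.RankPos] {𝓕 : Finset (NonminFlat M)} (h𝓕 : IsFlag 𝓕)
    (hE : topFlat M ∉ 𝓕) :
    reducedCharPoly (flagMatroid M 𝓕) = (X - 1) ^ 𝓕.card * ∏ F ∈ insert (topFlat M) 𝓕,
      intervalSum M qAnalogue (flagPred (insert (topFlat M) 𝓕) F) F.1 := by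
  have hne : (X - 1 : ℤ[X]) ≠ 0 := X_sub_C_ne_zero 1
  have : (flagMatroid M 𝓕).Nonempty := ⟨by
    obtain ⟨e, he, -⟩ := Set.exists_of_ssubset (topFlat M).2.2
    exact ⟨e, he⟩⟩
  apply mul_left_cancel₀ hne
  rw [X_sub_one_mul_reducedCharPoly, charPoly_flagMatroid h𝓕, ← mul_assoc, ← pow_succ',
    ← Finset.card_insert_of_notMem hE, ← Finset.prod_const, ← Finset.prod_mul_distrib]
  exact Finset.prod_congr rfl fun F _ ↦ (X_sub_one_mul_intervalSum M
    (h𝓕.insert_topFlat.flagPred_ssubset F) F.2.1.subset_ground).symm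

end FlagMatroid

/-! ### From characteristic polynomials to standard exponents -/

section FlagSum

variable {α : Type*} {M : Matroid α}

/-- The product of `w x y` over the pairs of consecutive members `x < y` of a flag, the empty set
included as initial member. -/
noncomputable def flagProd (w : Set α → Set α → ℤ[X]) (𝓖 : Finset (NonminFlat M)) : ℤ[X] :=
  ∏ F ∈ 𝓖, w (flagPred 𝓖 F) F.1

theorem IsFlag.mono {𝓕 𝓖 : Finset (NonminFlat M)} (h : IsFlag 𝓖) (h' : 𝓕 ⊆ 𝓖) : IsFlag 𝓕 :=
  IsChain.mono (Finset.coe_subset.2 h') h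

theorem isFlag_empty : IsFlag (∅ : Finset (NonminFlat M)) := by simp [IsFlag]

open Classical in
theorem flagProd_insert (w : Set α → Set α → ℤ[X]) {𝓖 : Finset (NonminFlat M)} {y : NonminFlat M}
    (h : ∀ F ∈ 𝓖, F < y) :
    flagProd w (insert y 𝓖) = w (⋃ F ∈ 𝓖, F.1) y.1 * flagProd w 𝓖 := by
  rw [flagProd, Finset.prod_insert fun hy ↦ (h y hy).false]
  congr 1
  · congr 1
    ext e
    simp only [mem_flagPred, Set.mem_iUnion, exists_prop, Finset.mem_insert]
    constructor
    · rintro ⟨G, rfl | hG, hlt, he⟩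
      exacts [hlt.false.elim, ⟨G, hG, he⟩]
    · rintro ⟨G, hG, he⟩
      exact ⟨G, Or.inr hG, h G hG, he⟩
  · refine Finset.prod_congr rfl fun F hF ↦ ?_
    congr 1
    ext e
    simp only [mem_flagPred, Finset.mem_insert]
    constructor
    · rintro ⟨G, rfl | hG, hlt, he⟩
      exacts [(hlt.trans (h F hF)).false.elim, ⟨G, hG, hlt, he⟩]
    · rintro ⟨G, hG, hlt, he⟩
      exact ⟨G, Or.inr hG, hlt, he⟩

variable [M.Finite]

open Classical in
/-- The flags with largest member `y`. -/
noncomputable def flagsWithMax (y : NonminFlat M) : Finset (Finset (NonminFlat M)) :=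
  {𝓖 | IsFlag 𝓖 ∧ y ∈ 𝓖 ∧ ∀ F ∈ 𝓖, F ≤ y}

theorem mem_flagsWithMax {y : NonminFlat M} {𝓖 : Finset (NonminFlat M)} :
    𝓖 ∈ flagsWithMax y ↔ IsFlag 𝓖 ∧ y ∈ 𝓖 ∧ ∀ F ∈ 𝓖, F ≤ y := by
  simp [flagsWithMax]

/-- The sum of `flagProd w` over the flags with largest member `y`. -/
noncomputable def flagSum (w : Set α → Set α → ℤ[X]) (y : NonminFlat M) : ℤ[X] :=
  ∑ 𝓖 ∈ flagsWithMax y, flagProd w 𝓖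

open Classical in
theorem sum_flags_eq (p : NonminFlat M → Prop) (hp : ∀ F G, F ≤ G → p G → p F)
    (f : Finset (NonminFlat M) → ℤ[X]) :
    ∑ 𝓖 : Finset (NonminFlat M) with IsFlag 𝓖 ∧ ∀ F ∈ 𝓖, p F, f 𝓖 =
      f ∅ + ∑ y with p y, ∑ 𝓖 ∈ flagsWithMax y, f 𝓖 := by
  have h : (Finset.univ.filter fun 𝓖 : Finset (NonminFlat M) ↦ IsFlag 𝓖 ∧ ∀ F ∈ 𝓖, p F) =
      insert ∅ ((Finset.univ.filter p).biUnion flagsWithMax) := by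
    ext 𝓖
    simp only [Finset.mem_filter, Finset.mem_univ, true_and, Finset.mem_insert, Finset.mem_biUnion,
      mem_flagsWithMax]
    constructor
    · rintro ⟨h𝓖, hpF⟩
      rcases 𝓖.eq_empty_or_nonempty with rfl | hne
      · exact Or.inl rfl
      · obtain ⟨y, hy⟩ := 𝓖.exists_maximal hne
        refine Or.inr ⟨y, hpF y hy.prop, h𝓖, hy.prop, fun F hF ↦ ?_⟩
        rcases h𝓖.total hF hy.prop with h | h
        exacts [h, hy.le_of_ge hF h]
    · rintro (rfl | ⟨y, hy, h𝓖, -, hle⟩)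
      · exact ⟨isFlag_empty, by simp⟩
      · exact ⟨h𝓖, fun F hF ↦ hp F y (hle F hF) hy⟩
  rw [h, Finset.sum_insert, Finset.sum_biUnion]
  · intro y _ z _ hyz
    refine Finset.disjoint_left.2 fun 𝓖 h1 h2 ↦ hyz ?_
    rw [mem_flagsWithMax] at h1 h2
    exact le_antisymm (h2.2.2 y h1.2.1) (h1.2.2 z h2.2.1)
  · simp [mem_flagsWithMax]

open Classical in
theorem flagSum_eq_sum_insert (w : Set α → Set α → ℤ[X]) (y : NonminFlat M) :
    flagSum w y = ∑ 𝓖 : Finset (NonminFlat M) with IsFlag 𝓖 ∧ ∀ F ∈ 𝓖, F < y,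
      flagProd w (insert y 𝓖) := by
  refine Finset.sum_bij' (fun 𝓖 _ ↦ 𝓖.erase y) (fun 𝓖 _ ↦ insert y 𝓖) ?_ ?_ ?_ ?_ ?_
  · intro 𝓖 h𝓖
    rw [mem_flagsWithMax] at h𝓖
    simp only [Finset.mem_filter, Finset.mem_univ, true_and, Finset.mem_erase]
    exact ⟨h𝓖.1.mono (Finset.erase_subset _ _),
      fun F hF ↦ lt_of_le_of_ne (h𝓖.2.2 F hF.2) hF.1⟩
  · intro 𝓖 h𝓖
    simp only [Finset.mem_filter, Finset.mem_univ, true_and] at h𝓖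
    rw [mem_flagsWithMax]
    refine ⟨?_, Finset.mem_insert_self _ _, ?_⟩
    · rw [IsFlag, Finset.coe_insert]
      exact IsChain.insert h𝓖.1 fun F hF _ ↦ Or.inr (h𝓖.2 F hF).le
    · intro F hF
      rcases Finset.mem_insert.1 hF with rfl | hF
      exacts [le_rfl, (h𝓖.2 F hF).le]
  · intro 𝓖 h𝓖
    exact Finset.insert_erase (mem_flagsWithMax.1 h𝓖).2.1
  · intro 𝓖 h𝓖
    simp only [Finset.mem_filter, Finset.mem_univ, true_and] at h𝓖
    exact Finset.erase_insert fun hy ↦ (h𝓖.2 y hy).false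
  · intro 𝓖 h𝓖
    rw [Finset.insert_erase (mem_flagsWithMax.1 h𝓖).2.1]

open Classical in
-- Transfer recursion: x is the second largest member of the flag, and the first term comes from the
-- flag {y}.
theorem flagSum_eq (w : Set α → Set α → ℤ[X]) (y : NonminFlat M) :
    flagSum w y = w ∅ y.1 + ∑ x with x < y, flagSum w x * w x.1 y.1 := by
  rw [flagSum_eq_sum_insert, sum_flags_eq (· < y) fun F G h h' ↦ h.trans_lt h']
  congr 1
  · rw [flagProd_insert w (by simp)]
    simp [flagProd]
  · refine Finset.sum_congr rfl fun x hx ↦ ?_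
    rw [flagSum, Finset.sum_mul]
    refine Finset.sum_congr rfl fun 𝓖 h𝓖 ↦ ?_
    rw [mem_flagsWithMax] at h𝓖
    rw [flagProd_insert w fun F hF ↦ (h𝓖.2.2 F hF).trans_lt (Finset.mem_filter.1 hx).2, mul_comm]
    congr 2
    ext e
    simp only [Set.mem_iUnion, exists_prop]
    exact ⟨fun ⟨F, hF, he⟩ ↦ h𝓖.2.2 F hF he, fun he ↦ ⟨x, h𝓖.2.1, he⟩⟩

/-- The polynomial `q + q^2 + ⋯ + q^{d - 1}`, where `d = rk y - rk x`. -/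
noncomputable def gapPoly (M : Matroid α) (x y : Set α) : ℤ[X] :=
  ∑ i ∈ Finset.Ico 1 (rk M y - rk M x), X ^ i

theorem qAnalogue_eq_one_add_gapPoly {x y : Set α} (h : rk M x < rk M y) :
    qAnalogue (rk M y - rk M x) = 1 + gapPoly M x y := by
  rw [qAnalogue, gapPoly, Finset.range_eq_Ico, Finset.sum_eq_sum_Ico_succ_bot (by omega), pow_zero]

theorem rk_lt_rk_of_lt {x y : NonminFlat M} (h : x < y) : rk M x.1 < rk M y.1 :=
  rk_lt_rk M x.2.1 h y.2.1.subset_ground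

open Classical in
theorem sum_intervalSum_between (g : ℕ → ℤ[X]) {z y : NonminFlat M} (hzy : z ≤ y) :
    ∑ x with z ≤ x ∧ x ≤ y, intervalSum M g x.1 y.1 = g (rk M y.1 - rk M z.1) := by
  rw [← sum_intervalSum M g y.2.1 ⟨z.1, z.2.1, hzy⟩]
  refine Finset.sum_bij' (fun x hx ↦ ⟨x.1, x.2.1, (Finset.mem_filter.1 hx).2.2⟩)
    (fun x hx ↦ ⟨x.1, x.2.1, z.2.2.trans_subset (Finset.mem_filter.1 hx).2⟩) ?_ ?_ ?_ ?_ ?_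
  · intro x hx
    exact Finset.mem_filter.2 ⟨Finset.mem_univ _, (Finset.mem_filter.1 hx).2.1⟩
  · intro x hx
    exact Finset.mem_filter.2 ⟨Finset.mem_univ _, (Finset.mem_filter.1 hx).2, x.2.2⟩
  all_goals intros; rfl

open Classical in
-- This is the Möbius identity over the whole interval from ∅ to y. Looplessness makes ∅ a flat, and
-- its term stands apart because `NonminFlat M` omits it.
theorem intervalSum_add_sum [M.Loopless] (g : ℕ → ℤ[X]) (y : NonminFlat M) :
    intervalSum M g ∅ y.1 + ∑ x with x ≤ y, intervalSum M g x.1 y.1 = g (rk M y.1) := by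
  have hcl : M.closure ∅ = ∅ := M.loops_eq_empty
  have hf : M.IsFlat ∅ := hcl ▸ M.isFlat_closure ∅
  have h := sum_intervalSum M g y.2.1 ⟨∅, hf, Set.empty_subset _⟩
  rw [rk_empty, Nat.sub_zero] at h
  rw [← h, ← Finset.add_sum_erase _ _ (Finset.mem_filter.2 ⟨Finset.mem_univ _, le_rfl⟩)]
  congr 1
  refine Finset.sum_bij' (fun x hx ↦ ⟨x.1, x.2.1, (Finset.mem_filter.1 hx).2⟩)
    (fun x hx ↦ ⟨x.1, x.2.1, ?_⟩) ?_ ?_ ?_ ?_ ?_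
  · refine hcl.trans_ssubset ((Set.empty_subset _).ssubset_of_ne fun hx0 ↦ ?_)
    exact (Finset.mem_erase.1 hx).1 (Subtype.ext hx0.symm)
  · intro x hx
    refine Finset.mem_erase.2 ⟨fun h ↦ ?_, Finset.mem_filter.2 ⟨Finset.mem_univ _, Set.empty_subset _⟩⟩
    have h1 : x.1 = ∅ := congrArg Subtype.val h
    exact (x.2.2.trans_eq h1).not_subset (Set.empty_subset _)
  · intro x hx
    exact Finset.mem_filter.2 ⟨Finset.mem_univ _, x.2.2⟩
  all_goals intros; rfl

open Classical in
-- Induction through the recursion for flag sums. Exchanging the two sums and collapsing the inner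
-- one by Möbius inversion leaves [rk y - rk z]_q = 1 + gap(z, y). The summands 1 accumulate the
-- flag sums of all z < y, and the gap terms reassemble into the recursion for the flag sum at y.
theorem flagSum_intervalSum [M.Loopless] (y : NonminFlat M) :
    flagSum (intervalSum M qAnalogue) y = 1 + ∑ x with x ≤ y, flagSum (gapPoly M) x := by
  induction y using WellFoundedLT.induction with
  | ind y ih =>
  have hyy : intervalSum M qAnalogue y.1 y.1 = 0 := by
    have h : groundDiff M y.1 y.1 = ∅ := by ext e; simp [mem_groundDiff]
    simp [intervalSum, h, qAnalogue]
  have hsplit : ∀ f : NonminFlat M → ℤ[X], ∑ x with x ≤ y, f x = f y + ∑ x with x < y, f x := by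
    intro f
    have : (Finset.univ.filter fun x ↦ x ≤ y) = insert y (Finset.univ.filter fun x ↦ x < y) := by
      ext x; simp [le_iff_eq_or_lt]
    rw [this, Finset.sum_insert (by simp)]
  have hη : gapPoly M y.1 y.1 = 0 := by simp [gapPoly]
  calc flagSum (intervalSum M qAnalogue) y
      = intervalSum M qAnalogue ∅ y.1 + ∑ x with x < y,
          (1 + ∑ z with z ≤ x, flagSum (gapPoly M) z) * intervalSum M qAnalogue x.1 y.1 := by
        rw [flagSum_eq]
        congr 1
        refine Finset.sum_congr rfl fun x hx ↦ ?_
        rw [ih x (Finset.mem_filter.1 hx).2]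
    -- The term x = y may be added since [0]_q = 0.
    _ = (intervalSum M qAnalogue ∅ y.1 + ∑ x with x ≤ y, intervalSum M qAnalogue x.1 y.1) +
          ∑ x with x ≤ y, ∑ z with z ≤ x,
            flagSum (gapPoly M) z * intervalSum M qAnalogue x.1 y.1 := by
        rw [hsplit, hsplit, hyy]
        simp only [mul_zero, Finset.sum_const_zero, zero_add, add_mul, one_mul,
          Finset.sum_add_distrib, Finset.sum_mul, add_assoc]
    _ = qAnalogue (rk M y.1) + ∑ z with z ≤ y, flagSum (gapPoly M) z *
          qAnalogue (rk M y.1 - rk M z.1) := by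
        rw [intervalSum_add_sum]
        congr 1
        rw [Finset.sum_comm' (t' := Finset.univ.filter (· ≤ y))
          (s' := fun z ↦ Finset.univ.filter fun x ↦ z ≤ x ∧ x ≤ y)]
        · refine Finset.sum_congr rfl fun z hz ↦ ?_
          rw [← Finset.mul_sum, sum_intervalSum_between _ (Finset.mem_filter.1 hz).2]
        · intro x z
          simp only [Finset.mem_filter, Finset.mem_univ, true_and]
          exact ⟨fun h ↦ ⟨⟨h.2, h.1⟩, h.2.trans h.1⟩, fun h ↦ ⟨h.1.2, h.1.1⟩⟩
    _ = 1 + gapPoly M ∅ y.1 + ∑ z with z < y, (flagSum (gapPoly M) z +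
          flagSum (gapPoly M) z * gapPoly M z.1 y.1) := by
        congr 1
        · have h0 : rk M (∅ : Set α) < rk M y.1 := by
            have := rk_lt_rk M (M.isFlat_closure ∅) y.2.2 y.2.1.subset_ground
            simpa using this
          rw [← qAnalogue_eq_one_add_gapPoly h0, rk_empty, Nat.sub_zero]
        · rw [hsplit, Nat.sub_self]
          simp only [qAnalogue, Finset.range_zero, Finset.sum_empty, mul_zero, zero_add]
          refine Finset.sum_congr rfl fun z hz ↦ ?_
          have := qAnalogue_eq_one_add_gapPoly (rk_lt_rk_of_lt (Finset.mem_filter.1 hz).2)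
          rw [qAnalogue] at this
          rw [this, mul_add, mul_one]
    _ = 1 + ∑ x with x ≤ y, flagSum (gapPoly M) x := by
        rw [hsplit, flagSum_eq (gapPoly M) y, Finset.sum_add_distrib]
        ring

open Classical in
theorem mem_properFlags [M.RankPos] {𝓕 : Finset (NonminFlat M)} :
    𝓕 ∈ properFlags M ↔ IsFlag 𝓕 ∧ ∀ F ∈ 𝓕, F < topFlat M := by
  simp only [properFlags, Finset.mem_filter, Finset.mem_univ, true_and]
  refine and_congr_right fun _ ↦ forall₂_congr fun F _ ↦ ?_
  rw [lt_iff_le_and_ne, and_iff_right (le_topFlat F), ne_eq, ne_eq, Subtype.ext_iff]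
  rfl

theorem X_sub_one_pow_dvd_reducedCharPoly [M.RankPos] {𝓕 : Finset (NonminFlat M)}
    (h : 𝓕 ∈ properFlags M) : (X - 1) ^ 𝓕.card ∣ reducedCharPoly (flagMatroid M 𝓕) := by
  rw [mem_properFlags] at h
  rw [reducedCharPoly_flagMatroid h.1 fun hE ↦ (h.2 _ hE).false]
  exact dvd_mul_right _ _

open Classical in
/-- The Poincaré polynomial as a sum over all flags of non-minimal flats. -/
theorem poincarePoly_eq_sum_flags [M.Loopless] [M.Nonempty] :
    poincarePoly M = ∑ 𝓖 : Finset (NonminFlat M) with IsFlag 𝓖, flagProd (gapPoly M) 𝓖 := by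
  have hm : (X - 1 : ℤ[X]).Monic := monic_X_sub_C 1
  have h1 : poincarePoly M = flagSum (intervalSum M qAnalogue) (topFlat M) := by
    rw [flagSum_eq_sum_insert, poincarePoly]
    refine Finset.sum_congr ?_ fun 𝓕 h𝓕 ↦ ?_
    · ext 𝓕
      simp [mem_properFlags]
    · have h𝓕' := mem_properFlags.1 (show 𝓕 ∈ properFlags M by
        rw [mem_properFlags]; simpa using h𝓕)
      rw [reducedCharPoly_flagMatroid h𝓕'.1 fun hE ↦ (h𝓕'.2 _ hE).false,
        mul_divByMonic_cancel_left _ (Monic.pow hm _)]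
      rfl
  -- The constant 1 in `flagSum_intervalSum` is the contribution of the empty flag, the other flags
  -- being grouped by their largest member.
  have h2 := sum_flags_eq (M := M) (fun _ ↦ True) (by simp) (flagProd (gapPoly M))
  simp only [implies_true, and_true] at h2
  rw [h1, flagSum_intervalSum, h2]
  congr 1
  refine Finset.sum_congr ?_ fun _ _ ↦ rfl
  ext x
  simp [le_topFlat]

open Classical in
/-- The exponent vectors of the monomials `∏ h_F^{a_F}` supported on a flag `F_1 < ⋯ < F_k` with
`a_{F_i} < rk F_i - rk F_{i-1}`. -/
noncomputable def standardExponents (M : Matroid α) [M.Finite] : Finset (NonminFlat M →₀ ℕ) :=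
  ({𝓖 | IsFlag 𝓖} : Finset (Finset (NonminFlat M))).biUnion fun 𝓖 ↦
    𝓖.finsupp fun F ↦ Finset.Ico 1 (rk M F.1 - rk M (flagPred 𝓖 F))

theorem support_of_mem_finsupp {𝓖 : Finset (NonminFlat M)} {c : NonminFlat M → ℕ}
    {a : NonminFlat M →₀ ℕ} (h : a ∈ 𝓖.finsupp fun F ↦ Finset.Ico 1 (c F)) : a.support = 𝓖 := by
  rw [Finset.mem_finsupp_iff] at h
  refine h.1.antisymm fun F hF ↦ ?_
  have := Finset.mem_Ico.1 (h.2 F hF)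
  rw [Finsupp.mem_support_iff]
  omega

theorem mem_standardExponents {a : NonminFlat M →₀ ℕ} :
    a ∈ standardExponents M ↔ IsFlag a.support ∧
      ∀ F ∈ a.support, a F < rk M F.1 - rk M (flagPred a.support F) := by
  simp only [standardExponents, Finset.mem_biUnion, Finset.mem_filter, Finset.mem_univ, true_and]
  constructor
  · rintro ⟨𝓖, h𝓖, ha⟩
    rw [support_of_mem_finsupp ha]
    exact ⟨h𝓖, fun F hF ↦ (Finset.mem_Ico.1 ((Finset.mem_finsupp_iff.1 ha).2 F hF)).2⟩
  · rintro ⟨h1, h2⟩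
    refine ⟨a.support, h1, Finset.mem_finsupp_iff.2 ⟨subset_rfl, fun F hF ↦ ?_⟩⟩
    have := Finsupp.mem_support_iff.1 hF
    exact Finset.mem_Ico.2 ⟨by omega, h2 F hF⟩

open Classical in
theorem prod_sum_eq_sum_finsupp {ι : Type*} (s : Finset ι) (t : ι → Finset ℕ) :
    ∏ i ∈ s, ∑ n ∈ t i, (X ^ n : ℤ[X]) = ∑ a ∈ s.finsupp t, X ^ (∑ i ∈ s, a i) := by
  rw [Finset.prod_sum, Finset.finsupp, Finset.sum_map]
  refine Finset.sum_congr rfl fun p _ ↦ ?_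
  rw [Finset.prod_pow_eq_pow_sum, ← Finset.sum_attach s]
  congr 1
  refine Finset.sum_congr rfl fun i _ ↦ ?_
  simp

theorem poincarePoly_eq_sum_standardExponents [M.Loopless] [M.Nonempty] :
    poincarePoly M = ∑ a ∈ standardExponents M, X ^ a.degree := by
  classical
  rw [poincarePoly_eq_sum_flags, standardExponents, Finset.sum_biUnion]
  · refine Finset.sum_congr (by ext; simp) fun 𝓖 _ ↦ ?_
    simp only [flagProd, gapPoly]
    rw [prod_sum_eq_sum_finsupp]
    refine Finset.sum_congr (by congr!) fun a ha ↦ ?_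
    rw [Finsupp.degree_apply, support_of_mem_finsupp ha]
  · intro 𝓖 _ 𝓗 _ hne
    refine Finset.disjoint_left.2 fun a h1 h2 ↦ hne ?_
    rw [← support_of_mem_finsupp h1, ← support_of_mem_finsupp h2]

end FlagSum

/-! ### Joins, atoms and hyperplanes of flats -/

section Flats

variable {α : Type*} {M : Matroid α}

/-- The join of two non-minimal flats. -/
def flatSup (P Q : NonminFlat M) : NonminFlat M :=
  ⟨M.closure (P.1 ∪ Q.1), M.isFlat_closure _, P.2.2.trans_subset
    (Set.subset_union_left.trans (M.subset_closure _
      (Set.union_subset P.2.1.subset_ground Q.2.1.subset_ground)))⟩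

theorem flatSup_le_iff {P Q R : NonminFlat M} : flatSup P Q ≤ R ↔ P ≤ R ∧ Q ≤ R := by
  have h : P.1 ∪ Q.1 ⊆ M.closure (P.1 ∪ Q.1) := M.subset_closure _
      (Set.union_subset P.2.1.subset_ground Q.2.1.subset_ground)
  constructor
  · intro hR
    have := h.trans hR
    exact ⟨Set.subset_union_left.trans this, Set.subset_union_right.trans this⟩
  · rintro ⟨hP, hQ⟩
    have := M.closure_subset_closure (Set.union_subset hP hQ)
    rwa [R.2.1.closure] at this

theorem le_flatSup_left (P Q : NonminFlat M) : P ≤ flatSup P Q := (flatSup_le_iff.1 le_rfl).1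

theorem le_flatSup_right (P Q : NonminFlat M) : Q ≤ flatSup P Q := (flatSup_le_iff.1 le_rfl).2

variable [M.Finite]

theorem one_le_rk (F : NonminFlat M) : 1 ≤ rk M F.1 := by
  have := rk_lt_rk M (M.isFlat_closure ∅) F.2.2 F.2.1.subset_ground
  omega

/-- A flat `G` of larger rank than `x ⊆ G` is spanned by a flat of corank one containing `x` and
one more element. -/
theorem exists_flat_insert {x G : Set α} (hG : M.IsFlat G) (hxG : x ⊆ G) (h : rk M x < rk M G) :
    ∃ e ∈ G, ∃ B, M.IsFlat B ∧ x ⊆ B ∧ M.closure (B ∪ {e}) = G ∧ rk M B + 1 = rk M G := by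
  obtain ⟨I, hI⟩ := M.exists_isBasis x (hxG.trans hG.subset_ground)
  obtain ⟨J, hJ, hIJ⟩ := hI.indep.subset_isBasis_of_subset (hI.subset.trans hxG) hG.subset_ground
  have hfin : J.Finite := M.ground_finite.subset hJ.indep.subset_ground
  have hrI : rk M x = I.ncard := by rw [← rk_eq_ncard M hI.indep, rk, rk, hI.eRk_eq_eRk]
  have hrJ : rk M G = J.ncard := by rw [← rk_eq_ncard M hJ.indep, rk, rk, hJ.eRk_eq_eRk]
  obtain ⟨e, heJ, heI⟩ : ∃ e ∈ J, e ∉ I := by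
    by_contra! hc
    have := Set.ncard_le_ncard hc (hfin.subset hIJ)
    omega
  refine ⟨e, hJ.subset heJ, M.closure (J \ {e}), M.isFlat_closure _, ?_, ?_, ?_⟩
  · exact hI.subset_closure.trans (M.closure_subset_closure
      fun a ha ↦ ⟨hIJ ha, fun hae ↦ heI (hae ▸ ha)⟩)
  · rw [Matroid.closure_union_closure_left_eq, Set.sdiff_union_of_subset (by simpa using heJ),
      hJ.closure_eq_closure, hG.closure]
  · rw [rk_closure, rk_eq_ncard M (hJ.indep.subset Set.sdiff_subset), hrJ,
      Set.ncard_sdiff_singleton_add_one heJ hfin]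

variable [M.Loopless]

variable (M) in
/-- The atom `cl {e}` of the lattice of flats. -/
def atomFlat (e : α) (he : e ∈ M.E) : NonminFlat M :=
  ⟨M.closure {e}, M.isFlat_closure _, by
    refine (M.closure_subset_closure (Set.empty_subset _)).ssubset_of_ne fun h ↦ ?_
    have h1 : e ∈ M.closure {e} := M.mem_closure_self e
    rw [← h, show M.closure ∅ = ∅ from M.loops_eq_empty] at h1
    exact h1⟩

theorem isMin_of_rk_le_one {A : NonminFlat M} (h : rk M A.1 ≤ 1) : IsMin A := by
  intro F hFA
  have := one_le_rk F
  exact subset_of_rk_le M F.2.1 hFA A.2.1.subset_ground (h.trans this)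

theorem isMin_atomFlat (e : α) (he : e ∈ M.E) : IsMin (atomFlat M e he) :=
  isMin_of_rk_le_one ((rk_closure M _).trans_le (rk_singleton_le M e))

theorem rk_eq_one_of_isMin {A : NonminFlat M} (hA : IsMin A) : rk M A.1 = 1 := by
  refine le_antisymm ?_ (one_le_rk A)
  obtain ⟨e, he, -⟩ := Set.exists_of_ssubset A.2.2
  have h : atomFlat M e (A.2.1.subset_ground he) ≤ A := by
    have := M.closure_subset_closure (Set.singleton_subset_iff.2 he)
    rwa [A.2.1.closure] at this
  exact (rk_mono M (hA h)).trans ((rk_closure M _).trans_le (rk_singleton_le M e))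

end Flats

/-! ### The elements h_F and spanning by standard monomials -/

section Ring

variable {α : Type*} {M : Matroid α} [M.Finite]

/-- The class of the variable `x_F` in `D(M)`. -/
noncomputable def xElt (F : NonminFlat M) : CohomologyRing M :=
  Ideal.Quotient.mk _ (MvPolynomial.X F)

open Classical in
/-- The element `h_F = ∑_{G ⊇ F} x_G` of `D(M)`. -/
noncomputable def hElt (F : NonminFlat M) : CohomologyRing M := ∑ G with F ≤ G, xElt G

theorem hElt_of_isMin {A : NonminFlat M} (hA : IsMin A) : hElt A = 0 := by
  classical
  rw [hElt]
  simp only [xElt]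
  rw [← map_sum]
  exact Ideal.Quotient.eq_zero_iff_mem.2 (Ideal.subset_span (Or.inr ⟨A, hA, by congr!⟩))

theorem not_isFlag_pair {P Q : NonminFlat M} [DecidableEq (NonminFlat M)] (h1 : ¬ P ≤ Q)
    (h2 : ¬ Q ≤ P) : ¬ IsFlag {P, Q} := by
  intro h
  rcases h.total (x := P) (y := Q) (by simp) (by simp) with h | h
  exacts [h1 h, h2 h]

theorem xElt_mul_xElt {P Q : NonminFlat M} (h1 : ¬ P ≤ Q) (h2 : ¬ Q ≤ P) :
    xElt P * xElt Q = 0 := by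
  classical
  have hne : P ≠ Q := by rintro rfl; exact h1 le_rfl
  rw [xElt, xElt, ← map_mul]
  refine Ideal.Quotient.eq_zero_iff_mem.2 (Ideal.subset_span (Or.inl
    ⟨{P, Q}, not_isFlag_pair h1 h2, ?_⟩))
  rw [Finset.prod_pair hne]

/-- If `h` is the sum of `x` over the upper intervals, then `h_P - h_{P ∨ Q}` is the sum of `x_H`
over the flats `H` above `P` and not above `Q`. -/
theorem sum_sub_sum_flatSup {R : Type*} [AddCommGroup R] (x : NonminFlat M → R)
    (P Q : NonminFlat M) [DecidableLE (NonminFlat M)] :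
    ∑ G with P ≤ G, x G - ∑ G with flatSup P Q ≤ G, x G = ∑ G with P ≤ G ∧ ¬ Q ≤ G, x G := by
  rw [sub_eq_iff_eq_add, ← Finset.sum_filter_add_sum_filter_not (Finset.univ.filter (P ≤ ·))
    (fun G ↦ ¬ Q ≤ G), Finset.filter_filter, Finset.filter_filter]
  simp only [not_not, flatSup_le_iff]

theorem flatSup_comm (P Q : NonminFlat M) : flatSup P Q = flatSup Q P :=
  Subtype.ext (congrArg M.closure (Set.union_comm _ _))

/-- The two factors are sums of x_H with P ≤ H, Q ≰ H and of x_K with Q ≤ K, P ≰ K. Any such H and K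
are incomparable, so every product vanishes. -/
theorem hElt_sub_mul_hElt_sub (P Q : NonminFlat M) :
    (hElt P - hElt (flatSup P Q)) * (hElt Q - hElt (flatSup P Q)) = 0 := by
  classical
  simp only [hElt]
  rw [sum_sub_sum_flatSup, flatSup_comm, sum_sub_sum_flatSup, Finset.sum_mul_sum]
  refine Finset.sum_eq_zero fun H hH ↦ Finset.sum_eq_zero fun K hK ↦ ?_
  simp only [Finset.mem_filter, Finset.mem_univ, true_and] at hH hK
  exact xElt_mul_xElt (fun h ↦ hK.2 (hH.1.trans h)) (fun h ↦ hH.2 (hK.1.trans h))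

theorem hElt_mul_hElt (P Q : NonminFlat M) : hElt P * hElt Q =
    hElt (flatSup P Q) * hElt P + hElt (flatSup P Q) * hElt Q -
      hElt (flatSup P Q) * hElt (flatSup P Q) := by
  linear_combination hElt_sub_mul_hElt_sub P Q

/-- The product `∏_{F ∈ s} h_F` over a multiset of non-minimal flats. -/
noncomputable def hProd (s : Multiset (NonminFlat M)) : CohomologyRing M := (s.map hElt).prod

theorem hProd_cons (F : NonminFlat M) (s : Multiset (NonminFlat M)) :
    hProd (F ::ₘ s) = hElt F * hProd s := by simp [hProd]

theorem hProd_add (s t : Multiset (NonminFlat M)) : hProd (s + t) = hProd s * hProd t := by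
  simp [hProd]

theorem hProd_replicate (n : ℕ) (F : NonminFlat M) :
    hProd (Multiset.replicate n F) = hElt F ^ n := by simp [hProd]

/-- The sum of the ranks of the members of a multiset of flats. -/
noncomputable def rankSum (s : Multiset (NonminFlat M)) : ℕ := (s.map fun F ↦ rk M F.1).sum

@[simp]
theorem rankSum_cons (F : NonminFlat M) (s : Multiset (NonminFlat M)) :
    rankSum (F ::ₘ s) = rk M F.1 + rankSum s := by simp [rankSum]

@[simp]
theorem rankSum_add (s t : Multiset (NonminFlat M)) :
    rankSum (s + t) = rankSum s + rankSum t := by simp [rankSum]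

theorem rankSum_le (s : Multiset (NonminFlat M)) : rankSum s ≤ s.card * rk M M.E := by
  rw [rankSum]
  refine (Multiset.sum_le_card_nsmul _ (rk M M.E) fun x hx ↦ ?_).trans (by simp)
  obtain ⟨F, -, rfl⟩ := Multiset.mem_map.1 hx
  exact rk_mono M F.2.1.subset_ground

variable [M.Loopless]

/-- This is the join relation for B and the atom of e, whose h vanishes. -/
theorem hElt_mul_self_of_closure_eq {B G : NonminFlat M} {e : α} (he : e ∈ M.E)
    (h : M.closure (B.1 ∪ {e}) = G.1) : hElt G * hElt G = hElt G * hElt B := by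
  have hG : flatSup B (atomFlat M e he) = G := Subtype.ext (by
    rw [← h]; exact M.closure_union_closure_right_eq _ _)
  have := hElt_mul_hElt B (atomFlat M e he)
  rw [hElt_of_isMin (isMin_atomFlat e he), hG] at this
  linear_combination this

theorem pow_succ_eq_mul_pow {R : Type*} [CommRing R] {a b : R} (h : a * a = a * b) (n : ℕ) :
    a ^ (n + 1) = a * b ^ n := by
  induction n with
  | zero => simp
  | succ n ih => rw [pow_succ, ih, mul_right_comm, h, pow_succ]; ring

/-- Choosing a corank one flat B with F ≤ B < G, the rule h_G^{n+1} = h_G h_B^n pushes all but one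
factor h_G down to B, where induction applies, and then back up. -/
theorem hElt_mul_pow (d : ℕ) {F G : NonminFlat M} (hFG : F ≤ G) (hd : rk M G.1 = rk M F.1 + d) :
    hElt F * hElt G ^ d = hElt G ^ (d + 1) := by
  induction d generalizing G with
  | zero =>
    have : F = G := le_antisymm hFG
      (subset_of_rk_le M F.2.1 hFG G.2.1.subset_ground (by omega))
    simp [this]
  | succ d ih =>
    obtain ⟨e, he, B, hB, hFB, hcl, hrk⟩ := exists_flat_insert G.2.1 hFG (by omega)
    have h1 := hElt_mul_self_of_closure_eq (B := ⟨B, hB, F.2.2.trans_subset hFB⟩)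
      (G.2.1.subset_ground he) hcl
    have h2 := ih (G := ⟨B, hB, F.2.2.trans_subset hFB⟩) hFB (by simp only; omega)
    rw [pow_succ_eq_mul_pow h1, pow_succ_eq_mul_pow h1, mul_left_comm, h2]

theorem hElt_pow_rk (d : ℕ) {G : NonminFlat M} (hd : rk M G.1 = d) : hElt G ^ d = 0 := by
  induction d generalizing G with
  | zero => have := one_le_rk G; omega
  | succ d ih =>
    rcases Nat.eq_zero_or_pos d with rfl | hpos
    · rw [zero_add, pow_one, hElt_of_isMin (isMin_of_rk_le_one hd.le)]
    · obtain ⟨e, he, B, hB, -, hcl, hrk⟩ := exists_flat_insert (x := ∅) G.2.1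
        (Set.empty_subset _) (by rw [rk_empty]; omega)
      have hB0 : M.closure ∅ ⊂ B := by
        refine (show M.closure ∅ = ∅ from M.loops_eq_empty).trans_ssubset
          ((Set.empty_subset _).ssubset_of_ne ?_)
        rintro rfl
        rw [rk_empty] at hrk
        omega
      have h1 := hElt_mul_self_of_closure_eq (B := ⟨B, hB, hB0⟩) (G.2.1.subset_ground he) hcl
      rw [pow_succ_eq_mul_pow h1, ih (by simp only; omega), mul_zero]

variable (M) in
/-- The standard monomials of degree `n` in the elements `h_F`. -/
def standardMonomials (n : ℕ) : Set (CohomologyRing M) :=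
  {y | ∃ a ∈ standardExponents M, a.degree = n ∧ hProd (Finsupp.toMultiset a) = y}

/-- Straightening. An incomparable pair is replaced through its join; in a flag, an excessive power
of F absorbs a factor of its predecessor G by h_G h_F^d = h_F^{d+1}, or vanishes if F has no
predecessor. Degree is kept and the rank sum grows. -/
theorem hProd_mem_span (s : Multiset (NonminFlat M)) :
    hProd s ∈ Submodule.span ℤ (standardMonomials M s.card) := by
  classical
  -- The rank sum is bounded by the degree times rk E, so the deficit is a terminating measure.
  induction hk : s.card * rk M M.E - rankSum s using Nat.strong_induction_on generalizing s with
  | _ k ih =>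
  have key : ∀ t : Multiset (NonminFlat M), t.card = s.card → rankSum s < rankSum t →
      hProd t ∈ Submodule.span ℤ (standardMonomials M s.card) := by
    intro t ht hst
    have h1 := rankSum_le t
    rw [← ht]
    refine ih _ ?_ t rfl
    rw [← hk, ht]
    rw [ht] at h1
    omega
  by_cases hflag : IsFlag s.toFinset
  · by_cases hstd : ∀ F ∈ s.toFinset, s.count F < rk M F.1 - rk M (flagPred s.toFinset F)
    · refine Submodule.subset_span ⟨Multiset.toFinsupp s, ?_, ?_, ?_⟩
      · rw [mem_standardExponents]
        simpa using And.intro hflag hstd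
      · conv_rhs => rw [← Multiset.toFinsupp_toMultiset s]
        rw [Finsupp.card_toMultiset]
        rfl
      · rw [Multiset.toFinsupp_toMultiset]
    · push Not at hstd
      obtain ⟨F, hF, hle⟩ := hstd
      rcases hflag.flagPred_eq F with h0 | ⟨G, hG, hGF, h0⟩
      · rw [h0, rk_empty, Nat.sub_zero] at hle
        obtain ⟨t, rfl⟩ := Multiset.le_iff_exists_add.1 (Multiset.le_count_iff_replicate_le.1 hle)
        rw [hProd_add, hProd_replicate, hElt_pow_rk _ rfl, zero_mul]
        exact zero_mem _
      · rw [h0] at hle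
        have hrk := rk_lt_rk_of_lt hGF
        set d := rk M F.1 - rk M G.1 with hd
        obtain ⟨t, ht⟩ := Multiset.le_iff_exists_add.1 (Multiset.le_count_iff_replicate_le.1 hle)
        have hGt : G ∈ t := by
          have : G ∈ s := by simpa using hG
          rw [ht, Multiset.mem_add] at this
          refine this.resolve_left fun h ↦ hGF.ne (Multiset.eq_of_mem_replicate h)
        obtain ⟨u, rfl⟩ := Multiset.exists_cons_of_mem hGt
        have h1 : hProd s = hProd (Multiset.replicate (d + 1) F + u) := by
          rw [ht, hProd_add, hProd_add, hProd_cons, hProd_replicate, hProd_replicate,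
            ← hElt_mul_pow d hGF.le (by omega)]
          ring
        rw [h1]
        refine key _ ?_ ?_
        · rw [ht]; simp
        · rw [ht, Multiset.replicate_succ]; simp; omega
  · obtain ⟨P, hP, Q, hQ, h1, h2⟩ : ∃ P ∈ s, ∃ Q ∈ s, ¬ P ≤ Q ∧ ¬ Q ≤ P := by
      by_contra! hc
      refine hflag fun P hP Q hQ _ ↦ ?_
      by_cases h : P ≤ Q
      · exact Or.inl h
      · exact Or.inr (hc P (by simpa using hP) Q (by simpa using hQ) h)
    obtain ⟨t, rfl⟩ := Multiset.exists_cons_of_mem hP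
    obtain ⟨u, rfl⟩ := Multiset.exists_cons_of_mem
      ((Multiset.mem_cons.1 hQ).resolve_left (by rintro rfl; exact h1 le_rfl))
    have hPJ : P < flatSup P Q := lt_of_le_not_ge (le_flatSup_left P Q)
      fun h ↦ h2 ((le_flatSup_right P Q).trans h)
    have hQJ : Q < flatSup P Q := lt_of_le_not_ge (le_flatSup_right P Q)
      fun h ↦ h1 ((le_flatSup_left P Q).trans h)
    have hrP := rk_lt_rk_of_lt hPJ
    have hrQ := rk_lt_rk_of_lt hQJ
    set J := flatSup P Q with hJ
    have h3 : hProd (P ::ₘ Q ::ₘ u) =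
        hProd (J ::ₘ P ::ₘ u) + hProd (J ::ₘ Q ::ₘ u) - hProd (J ::ₘ J ::ₘ u) := by
      simp only [hProd_cons]
      linear_combination hProd u * hElt_mul_hElt P Q
    rw [h3]
    refine sub_mem (add_mem ?_ ?_) ?_ <;> refine key _ (by simp) ?_ <;>
      simp only [rankSum_cons] <;> omega

omit [M.Loopless] in
-- The passage from x to h is unitriangular, hence invertible over ℤ by descending induction.
theorem xElt_mem_span (F : NonminFlat M) : xElt F ∈ Submodule.span ℤ (Set.range (hElt (M := M))) := by
  classical
  induction F using WellFoundedGT.induction with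
  | ind F ih =>
  have h : (Finset.univ.filter fun G ↦ F ≤ G) = insert F (Finset.univ.filter fun G ↦ F < G) := by
    ext G; simp [le_iff_eq_or_lt, eq_comm]
  have h2 : xElt F = hElt F - ∑ G with F < G, xElt G := by
    rw [hElt, h, Finset.sum_insert (by simp), add_sub_cancel_right]
  rw [h2]
  exact sub_mem (Submodule.subset_span ⟨F, rfl⟩)
    (Submodule.sum_mem _ fun G hG ↦ ih G (Finset.mem_filter.1 hG).2)

theorem prod_xElt_mem_span (s : Multiset (NonminFlat M)) :
    (s.map xElt).prod ∈ Submodule.span ℤ (standardMonomials M s.card) := by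
  have h : ∀ s : Multiset (NonminFlat M), (s.map xElt).prod ∈
      Submodule.span ℤ {y | ∃ t : Multiset (NonminFlat M), t.card = s.card ∧ hProd t = y} := by
    intro s
    induction s using Multiset.induction_on with
    | empty => exact Submodule.subset_span ⟨0, rfl, by simp [hProd]⟩
    | cons F s ih =>
      rw [Multiset.map_cons, Multiset.prod_cons]
      have h1 := Submodule.mul_mem_mul (xElt_mem_span F) ih
      rw [Submodule.span_mul_span] at h1
      refine Submodule.span_mono ?_ h1
      rintro _ ⟨_, ⟨G, rfl⟩, _, ⟨t, ht, rfl⟩, rfl⟩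
      exact ⟨G ::ₘ t, by simp [ht], hProd_cons G t⟩
  refine Submodule.span_le.2 ?_ (h s)
  rintro _ ⟨t, ht, rfl⟩
  rw [← ht]
  exact hProd_mem_span t

theorem weight_two (a : NonminFlat M →₀ ℕ) :
    Finsupp.weight (fun _ : NonminFlat M ↦ 2) a = 2 * a.degree := by
  rw [Finsupp.weight_apply, Finsupp.degree_apply, Finset.mul_sum, Finsupp.sum]
  exact Finset.sum_congr rfl fun F _ ↦ by simp [mul_comm]

theorem mk_monomial (a : NonminFlat M →₀ ℕ) (c : ℤ) :
    Ideal.Quotient.mkₐ ℤ (cohomologyIdeal M) (MvPolynomial.monomial a c) =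
      c • ((Finsupp.toMultiset a).map xElt).prod := by
  rw [MvPolynomial.monomial_eq, Finsupp.toMultiset_map, Finsupp.prod_toMultiset,
    ← MvPolynomial.smul_eq_C_mul, map_smul]
  congr 1
  rw [Finsupp.prod_mapDomain_index (by simp) (by simp [pow_add]), Finsupp.prod, Finsupp.prod, map_prod]
  simp [xElt]

theorem cohomologyPiece_two_mul (n : ℕ) :
    cohomologyPiece M (2 * n) = Submodule.span ℤ (standardMonomials M n) := by
  apply le_antisymm
  · rintro _ ⟨p, hp, rfl⟩
    rw [p.as_sum, map_sum]
    refine Submodule.sum_mem _ fun a ha ↦ ?_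
    have h1 : Finsupp.weight (fun _ : NonminFlat M ↦ 2) a = 2 * n :=
      hp (MvPolynomial.mem_support_iff.1 ha)
    rw [weight_two] at h1
    rw [AlgHom.toLinearMap_apply, mk_monomial]
    have h2 := prod_xElt_mem_span (Finsupp.toMultiset a)
    rw [Finsupp.card_toMultiset, show (a.sum fun _ ↦ id) = n by
      change a.degree = n; omega] at h2
    exact Submodule.smul_mem _ _ h2
  · refine Submodule.span_le.2 ?_
    rintro _ ⟨a, -, rfl, rfl⟩
    have h : ∀ s : Multiset (NonminFlat M), hProd s ∈ cohomologyPiece M (2 * s.card) := by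
      intro s
      induction s using Multiset.induction_on with
      | empty => exact ⟨1, MvPolynomial.isWeightedHomogeneous_one _ _, by simp [hProd]⟩
      | cons F s ih =>
        classical
        obtain ⟨p, hp, hps⟩ := ih
        refine ⟨(∑ G with F ≤ G, MvPolynomial.X G) * p, ?_, ?_⟩
        · rw [Multiset.card_cons, mul_add, mul_one, add_comm]
          refine MvPolynomial.IsWeightedHomogeneous.mul ?_ hp
          exact Submodule.sum_mem (MvPolynomial.weightedHomogeneousSubmodule ℤ _ 2)
            fun G _ ↦ MvPolynomial.isWeightedHomogeneous_X ℤ _ G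
        · rw [hProd_cons, ← hps, AlgHom.toLinearMap_apply, AlgHom.toLinearMap_apply, map_mul,
            map_sum]
          congr 1
    have h2 := h (Finsupp.toMultiset a)
    rwa [Finsupp.card_toMultiset] at h2

theorem cohomologyPiece_odd {i : ℕ} (hi : ¬ 2 ∣ i) : cohomologyPiece M i = ⊥ := by
  rw [eq_bot_iff]
  rintro _ ⟨p, hp, rfl⟩
  have : p = 0 := by
    ext a
    by_contra h
    have h1 : Finsupp.weight (fun _ : NonminFlat M ↦ 2) a = i := hp h
    exact hi ⟨a.degree, by rw [← h1, weight_two]⟩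
  simp [this]

end Ring

/-! ### The dragon Hall–Rado condition -/

section HallRado

variable {α : Type*} {M : Matroid α}

/-- The union of the members of a multiset of flats. -/
def multisetUnion (t : Multiset (NonminFlat M)) : Set α := {e | ∃ F ∈ t, e ∈ F.1}

theorem multisetUnion_cons (F : NonminFlat M) (t : Multiset (NonminFlat M)) :
    multisetUnion (F ::ₘ t) = F.1 ∪ multisetUnion t := by
  ext e; simp only [multisetUnion, Multiset.mem_cons, Set.mem_ofPred_eq, Set.mem_union,
    exists_eq_or_imp]

theorem multisetUnion_mono {s t : Multiset (NonminFlat M)} (h : s ≤ t) :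
    multisetUnion s ⊆ multisetUnion t := fun _ ⟨F, hF, he⟩ ↦ ⟨F, Multiset.mem_of_le h hF, he⟩

theorem forall_le_cons_iff {β : Type*} (a : β) (s : Multiset β) (p : Multiset β → Prop) :
    (∀ t ≤ a ::ₘ s, p t) ↔ (∀ t ≤ s, p t) ∧ ∀ t ≤ s, p (a ::ₘ t) := by
  simp only [← Multiset.mem_powerset, Multiset.powerset_cons, Multiset.mem_add, Multiset.mem_map]
  constructor
  · exact fun h ↦ ⟨fun t ht ↦ h t (Or.inl ht), fun t ht ↦ h _ (Or.inr ⟨t, ht, rfl⟩)⟩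
  · rintro ⟨h1, h2⟩ t (ht | ⟨t, ht, rfl⟩)
    exacts [h1 t ht, h2 t ht]

/-- The dragon Hall–Rado condition for a multiset of flats in the contraction of `M` by `x`. -/
def DragonHallRado (x : Set α) (u : Multiset (NonminFlat M)) : Prop :=
  ∀ t ≤ u, t ≠ 0 → rk M x + t.card + 1 ≤ rk M (x ∪ multisetUnion t)

/-- All submultisets `t` of `u` satisfy `rk (x ∪ Y ∪ ⋃ t) ≥ rk x + #t + k`. -/
def HasExcess (x Y : Set α) (u : Multiset (NonminFlat M)) (k : ℕ) : Prop :=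
  ∀ t ≤ u, rk M x + t.card + k ≤ rk M (x ∪ Y ∪ multisetUnion t)

theorem dragonHallRado_cons (x : Set α) (P : NonminFlat M) (u : Multiset (NonminFlat M)) :
    DragonHallRado x (P ::ₘ u) ↔ DragonHallRado x u ∧ HasExcess x P.1 u 2 := by
  rw [DragonHallRado, forall_le_cons_iff]
  simp only [ne_eq, Multiset.cons_ne_zero, not_false_eq_true, forall_const, Multiset.card_cons,
    multisetUnion_cons, ← Set.union_assoc]
  rfl

theorem hasExcess_cons (x Y : Set α) (P : NonminFlat M) (u : Multiset (NonminFlat M)) (k : ℕ) :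
    HasExcess x Y (P ::ₘ u) k ↔ HasExcess x Y u k ∧ HasExcess x (Y ∪ P.1) u (k + 1) := by
  rw [HasExcess, forall_le_cons_iff]
  simp only [Multiset.card_cons, multisetUnion_cons, ← Set.union_assoc, HasExcess]
  simp only [add_assoc, add_comm 1]

variable [M.Finite]

theorem HasExcess.mono {x Y Z : Set α} {u : Multiset (NonminFlat M)} {k l : ℕ}
    (h : HasExcess x Y u k) (hYZ : Y ⊆ Z) (hl : l ≤ k) : HasExcess x Z u l := fun t ht ↦
  (Nat.add_le_add_left hl _).trans ((h t ht).trans (rk_mono M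
    (Set.union_subset_union_left _ (Set.union_subset_union_right _ hYZ))))

theorem hasExcess_flatSup (x : Set α) (P Q : NonminFlat M) (u : Multiset (NonminFlat M)) (k : ℕ) :
    HasExcess x (flatSup P Q).1 u k ↔ HasExcess x (P.1 ∪ Q.1) u k := by
  refine forall₂_congr fun t _ ↦ ?_
  rw [show rk M (x ∪ (flatSup P Q).1 ∪ multisetUnion t) = _ from
    rk_union_eq_of_closure_eq M (Matroid.closure_union_closure_right_eq M x (P.1 ∪ Q.1)) _]

/-- Submodularity. If t₁ violates the condition for P and t₂ that for Q, their rank bounds add up to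
at most 2 rk x + #t₁ + #t₂ + 2. The union t₁ ∪ t₂ has excess 3 and t₁ ∩ t₂ has excess at least 0,
which forces one more. -/
theorem HasExcess.or_of_union {x P Q : Set α} {u : Multiset (NonminFlat M)}
    (h : HasExcess x (P ∪ Q) u 3) (hu : DragonHallRado x u) :
    HasExcess x P u 2 ∨ HasExcess x Q u 2 := by
  classical
  by_contra! hc
  simp only [HasExcess, not_forall, not_le] at hc
  obtain ⟨⟨t₁, ht₁, h₁⟩, t₂, ht₂, h₂⟩ := hc
  have hsub := rk_inter_add_rk_union_le M (x ∪ P ∪ multisetUnion t₁) (x ∪ Q ∪ multisetUnion t₂)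
  have hU := h (t₁ ∪ t₂) (Multiset.union_le ht₁ ht₂)
  have hU' : rk M (x ∪ (P ∪ Q) ∪ multisetUnion (t₁ ∪ t₂)) ≤
      rk M (x ∪ P ∪ multisetUnion t₁ ∪ (x ∪ Q ∪ multisetUnion t₂)) := by
    refine rk_mono M ?_
    rintro e ((he | he | he) | ⟨F, hF, he⟩)
    · exact Or.inl (Or.inl (Or.inl he))
    · exact Or.inl (Or.inl (Or.inr he))
    · exact Or.inr (Or.inl (Or.inr he))
    · rcases Multiset.mem_union.1 hF with hF | hF
      exacts [Or.inl (Or.inr ⟨F, hF, he⟩), Or.inr (Or.inr ⟨F, hF, he⟩)]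
  have hI : rk M x + (t₁ ∩ t₂).card ≤ rk M (x ∪ multisetUnion (t₁ ∩ t₂)) := by
    by_cases h0 : t₁ ∩ t₂ = 0
    · rw [h0]
      exact rk_mono M Set.subset_union_left
    · have := hu (t₁ ∩ t₂) ((Multiset.inter_le_left).trans ht₁) h0
      omega
  have hI' : rk M (x ∪ multisetUnion (t₁ ∩ t₂)) ≤
      rk M ((x ∪ P ∪ multisetUnion t₁) ∩ (x ∪ Q ∪ multisetUnion t₂)) := by
    refine rk_mono M (Set.union_subset (fun e he ↦ ⟨Or.inl (Or.inl he), Or.inl (Or.inl he)⟩)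
      fun e he ↦ ⟨Or.inr ?_, Or.inr ?_⟩)
    exacts [multisetUnion_mono Multiset.inter_le_left he,
      multisetUnion_mono Multiset.inter_le_right he]
  have hcard : (t₁ ∪ t₂).card + (t₁ ∩ t₂).card = t₁.card + t₂.card := by
    rw [← Multiset.card_add, Multiset.union_add_inter, Multiset.card_add]
  omega

open Classical in
-- Let D be the condition on u, a and b the excess 2 conditions for P and Q, and c the excess 3
-- condition for P ∪ Q, all as 0/1 values. The four terms add up to D c (1 - a)(1 - b), which is
-- zero by `HasExcess.or_of_union`.
theorem dragonHallRado_exchange (x : Set α) (P Q : NonminFlat M) (u : Multiset (NonminFlat M)) :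
    (if DragonHallRado x (P ::ₘ Q ::ₘ u) then 1 else 0 : ℤ) -
      (if DragonHallRado x (P ::ₘ flatSup P Q ::ₘ u) then 1 else 0) -
      (if DragonHallRado x (flatSup P Q ::ₘ Q ::ₘ u) then 1 else 0) +
      (if DragonHallRado x (flatSup P Q ::ₘ flatSup P Q ::ₘ u) then 1 else 0) = 0 := by
  have hP : P.1 ∪ (flatSup P Q).1 = (flatSup P Q).1 :=
    Set.union_eq_self_of_subset_left (le_flatSup_left P Q)
  have hQ : (flatSup P Q).1 ∪ Q.1 = (flatSup P Q).1 :=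
    Set.union_eq_self_of_subset_right (le_flatSup_right P Q)
  simp only [dragonHallRado_cons, hasExcess_cons, hP, hQ, Set.union_self, hasExcess_flatSup]
  have h1 : HasExcess x (P.1 ∪ Q.1) u 3 → HasExcess x (P.1 ∪ Q.1) u 2 :=
    fun h ↦ h.mono subset_rfl (by omega)
  have h2 : HasExcess x (P.1 ∪ Q.1) u 3 → DragonHallRado x u →
    HasExcess x P.1 u 2 ∨ HasExcess x Q.1 u 2 := fun h hu ↦ h.or_of_union hu
  by_cases hD : DragonHallRado x u
  · by_cases hc : HasExcess x (P.1 ∪ Q.1) u 3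
    · have h1 := h1 hc
      rcases h2 hc hD with ha | ha
      · by_cases hb : HasExcess x Q.1 u 2 <;> simp [hD, hc, h1, ha, hb]
      · by_cases hb : HasExcess x P.1 u 2 <;> simp [hD, hc, h1, ha, hb]
    · simp [hc]
  · simp [hD]

/-- An atom raises the rank of x by at most 1, whereas the submultiset {A} requires 2. -/
theorem not_dragonHallRado_cons_of_isMin [M.Loopless] (x : Set α) {A : NonminFlat M}
    (hA : IsMin A) (u : Multiset (NonminFlat M)) : ¬ DragonHallRado x (A ::ₘ u) := by
  rw [dragonHallRado_cons]
  rintro ⟨-, h⟩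
  have h1 := h 0 zero_le
  have h3 : multisetUnion (M := M) 0 = ∅ := by simp [multisetUnion]
  rw [h3, Set.union_empty, Multiset.card_zero] at h1
  have := rk_union_le M x A.1
  rw [rk_eq_one_of_isMin hA] at this
  omega

end HallRado

/-! ### Functionals attached to flags and their triangularity -/

section Functional

variable {α : Type*} {M : Matroid α}

open Classical in
/-- The members of `𝓕` that do not contain `Q`; for a flag `𝓕` they form an initial segment. -/
noncomputable def flagBlock (𝓕 : Finset (NonminFlat M)) (Q : NonminFlat M) :
    Finset (NonminFlat M) := 𝓕.filter (¬ Q ≤ ·)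

theorem mem_flagBlock {𝓕 : Finset (NonminFlat M)} {Q F : NonminFlat M} :
    F ∈ flagBlock 𝓕 Q ↔ F ∈ 𝓕 ∧ ¬ Q ≤ F := by simp [flagBlock]

/-- The union of a finite set of flats. -/
def finsetUnion (i : Finset (NonminFlat M)) : Set α := {e | ∃ F ∈ i, e ∈ F.1}

variable [M.Finite]

open Classical in
/-- The members of `s` belonging to the minor of `M` indexed by the initial segment `i`. -/
noncomputable def blockPart (𝓕 : Finset (NonminFlat M)) (s : Multiset (NonminFlat M))
    (i : Finset (NonminFlat M)) : Multiset (NonminFlat M) := s.filter (flagBlock 𝓕 · = i)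

theorem blockPart_cons_of_eq {𝓕 : Finset (NonminFlat M)} {P : NonminFlat M}
    {i : Finset (NonminFlat M)} (h : flagBlock 𝓕 P = i) (s : Multiset (NonminFlat M)) :
    blockPart 𝓕 (P ::ₘ s) i = P ::ₘ blockPart 𝓕 s i :=
  Multiset.filter_cons_of_pos (p := (flagBlock 𝓕 · = i)) s h

theorem blockPart_cons_of_ne {𝓕 : Finset (NonminFlat M)} {P : NonminFlat M}
    {i : Finset (NonminFlat M)} (h : flagBlock 𝓕 P ≠ i) (s : Multiset (NonminFlat M)) :
    blockPart 𝓕 (P ::ₘ s) i = blockPart 𝓕 s i :=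
  Multiset.filter_cons_of_neg (p := (flagBlock 𝓕 · = i)) s h

open Classical in
/-- The local factor of `hallRadoValue` at the minor of `M` indexed by the initial segment `i`. -/
noncomputable def blockValue (𝓕 : Finset (NonminFlat M)) (f s : Multiset (NonminFlat M))
    (i : Finset (NonminFlat M)) : ℤ :=
  if (blockPart 𝓕 s i).card = (blockPart 𝓕 f i).card ∧
    DragonHallRado (finsetUnion i) (blockPart 𝓕 s i) then 1 else 0

/-- The value on `∏_{G ∈ s} h_G` of the functional attached to the flag `𝓕` and the exponents
`f`: it splits `s` among the minors of `M` between consecutive members of `𝓕` and tests the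
dragon Hall–Rado condition in each of them. -/
noncomputable def hallRadoValue (𝓕 : Finset (NonminFlat M)) (f s : Multiset (NonminFlat M)) : ℤ :=
  ∏ i, blockValue 𝓕 f s i

theorem flagBlock_flatSup [DecidableEq (NonminFlat M)] (𝓕 : Finset (NonminFlat M))
    (P Q : NonminFlat M) : flagBlock 𝓕 (flatSup P Q) = flagBlock 𝓕 P ∪ flagBlock 𝓕 Q := by
  ext F
  simp only [mem_flagBlock, Finset.mem_union, flatSup_le_iff]
  tauto

theorem flagBlock_total {𝓕 : Finset (NonminFlat M)} (h𝓕 : IsFlag 𝓕) (P Q : NonminFlat M) :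
    flagBlock 𝓕 P ⊆ flagBlock 𝓕 Q ∨ flagBlock 𝓕 Q ⊆ flagBlock 𝓕 P := by
  by_contra! h
  obtain ⟨F, hFP, hFQ⟩ := Finset.not_subset.1 h.1
  obtain ⟨G, hGQ, hGP⟩ := Finset.not_subset.1 h.2
  simp only [mem_flagBlock, not_and, not_not] at *
  rcases h𝓕.total hFP.1 hGQ.1 with h | h
  · exact hGQ.2 ((hFQ hFP.1).trans h)
  · exact hFP.2 ((hGP hGQ.1).trans h)

theorem blockValue_cons_of_ne {𝓕 : Finset (NonminFlat M)} {P Q : NonminFlat M}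
    {f : Multiset (NonminFlat M)} {i : Finset (NonminFlat M)} (hP : flagBlock 𝓕 P ≠ i)
    (hQ : flagBlock 𝓕 Q ≠ i) (s : Multiset (NonminFlat M)) :
    blockValue 𝓕 f (P ::ₘ s) i = blockValue 𝓕 f (Q ::ₘ s) i := by
  classical
  rw [blockValue, blockValue, blockPart_cons_of_ne hP, blockPart_cons_of_ne hQ]

/-- Some member of 𝓕 contains P but not Q, so P lies in the set contracted in the minor of Q. There
P ∨ Q and Q are indistinguishable. -/
theorem hallRadoValue_cons_flatSup (𝓕 : Finset (NonminFlat M)) (f : Multiset (NonminFlat M))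
    {P Q : NonminFlat M} (h : flagBlock 𝓕 P ⊂ flagBlock 𝓕 Q) (s : Multiset (NonminFlat M)) :
    hallRadoValue 𝓕 f (flatSup P Q ::ₘ s) = hallRadoValue 𝓕 f (Q ::ₘ s) := by
  classical
  have hJ : flagBlock 𝓕 (flatSup P Q) = flagBlock 𝓕 Q := by
    rw [flagBlock_flatSup, Finset.union_eq_right.2 h.subset]
  obtain ⟨F, hFQ, hFP⟩ := Finset.exists_of_ssubset h
  have hPF : P ≤ F := by
    by_contra hc
    exact hFP (mem_flagBlock.2 ⟨(mem_flagBlock.1 hFQ).1, hc⟩)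
  refine Finset.prod_congr rfl fun i _ ↦ ?_
  by_cases hi : flagBlock 𝓕 Q = i
  · subst hi
    have hP : P.1 ⊆ finsetUnion (flagBlock 𝓕 Q) := fun e he ↦ ⟨F, hFQ, hPF he⟩
    have hx : finsetUnion (flagBlock 𝓕 Q) ∪ (P.1 ∪ Q.1) = finsetUnion (flagBlock 𝓕 Q) ∪ Q.1 := by
      rw [← Set.union_assoc, Set.union_eq_self_of_subset_right hP]
    have hiff : ∀ u : Multiset (NonminFlat M),
        DragonHallRado (finsetUnion (flagBlock 𝓕 Q)) (flatSup P Q ::ₘ u) ↔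
          DragonHallRado (finsetUnion (flagBlock 𝓕 Q)) (Q ::ₘ u) := fun u ↦ by
      rw [dragonHallRado_cons, dragonHallRado_cons, hasExcess_flatSup, HasExcess, HasExcess, hx]
    rw [blockValue, blockValue, blockPart_cons_of_eq hJ, blockPart_cons_of_eq rfl,
      Multiset.card_cons, Multiset.card_cons]
    simp only [hiff]
  · exact blockValue_cons_of_ne (hJ.symm ▸ hi) hi s

/-- The values `hallRadoValue` respect the relation `(h_P - h_{P ∨ Q})(h_Q - h_{P ∨ Q}) = 0`. -/
theorem hallRadoValue_exchange {𝓕 : Finset (NonminFlat M)} (h𝓕 : IsFlag 𝓕)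
    (f : Multiset (NonminFlat M)) (P Q : NonminFlat M) (s : Multiset (NonminFlat M)) :
    hallRadoValue 𝓕 f (P ::ₘ Q ::ₘ s) - hallRadoValue 𝓕 f (P ::ₘ flatSup P Q ::ₘ s) -
      hallRadoValue 𝓕 f (flatSup P Q ::ₘ Q ::ₘ s) +
      hallRadoValue 𝓕 f (flatSup P Q ::ₘ flatSup P Q ::ₘ s) = 0 := by
  classical
  -- In a common minor the identity is the local exchange times a constant factor; in different
  -- minors the four terms cancel in pairs.
  by_cases heq : flagBlock 𝓕 P = flagBlock 𝓕 Q
  · have hJ : flagBlock 𝓕 (flatSup P Q) = flagBlock 𝓕 Q := by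
      rw [flagBlock_flatSup, heq, Finset.union_self]
    have hrest : ∀ A B : NonminFlat M, flagBlock 𝓕 A = flagBlock 𝓕 Q →
        flagBlock 𝓕 B = flagBlock 𝓕 Q → hallRadoValue 𝓕 f (A ::ₘ B ::ₘ s) =
        (if DragonHallRado (finsetUnion (flagBlock 𝓕 Q))
          (A ::ₘ B ::ₘ blockPart 𝓕 s (flagBlock 𝓕 Q)) then 1 else 0) *
        ((if (blockPart 𝓕 s (flagBlock 𝓕 Q)).card + 1 + 1 =
          (blockPart 𝓕 f (flagBlock 𝓕 Q)).card then 1 else 0) *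
          ∏ i ∈ Finset.univ.erase (flagBlock 𝓕 Q), blockValue 𝓕 f s i) := by
      intro A B hA hB
      rw [hallRadoValue, ← Finset.mul_prod_erase _ _ (Finset.mem_univ (flagBlock 𝓕 Q)),
        ← mul_assoc]
      congr 1
      · rw [blockValue, blockPart_cons_of_eq hA, blockPart_cons_of_eq hB,
          Multiset.card_cons, Multiset.card_cons, ite_zero_mul_ite_zero, mul_one]
        simp only [and_comm]
      · refine Finset.prod_congr rfl fun i hi ↦ ?_
        have hi := (Finset.mem_erase.1 hi).1.symm
        rw [blockValue, blockValue, blockPart_cons_of_ne (hA.symm ▸ hi),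
          blockPart_cons_of_ne (hB.symm ▸ hi)]
    rw [hrest P Q heq rfl, hrest P _ heq hJ, hrest _ Q hJ rfl, hrest _ _ hJ hJ]
    linear_combination ((if (blockPart 𝓕 s (flagBlock 𝓕 Q)).card + 1 + 1 =
          (blockPart 𝓕 f (flagBlock 𝓕 Q)).card then 1 else 0) *
          ∏ i ∈ Finset.univ.erase (flagBlock 𝓕 Q), blockValue 𝓕 f s i) *
        dragonHallRado_exchange (finsetUnion (flagBlock 𝓕 Q)) P Q
          (blockPart 𝓕 s (flagBlock 𝓕 Q))
  · rcases flagBlock_total h𝓕 P Q with h | h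
    · have := hallRadoValue_cons_flatSup 𝓕 f (h.ssubset_of_ne heq)
      rw [Multiset.cons_swap P Q, Multiset.cons_swap P (flatSup P Q),
        Multiset.cons_swap (flatSup P Q) Q, this (P ::ₘ s), this (flatSup P Q ::ₘ s)]
      ring
    · have := hallRadoValue_cons_flatSup 𝓕 f (h.ssubset_of_ne (Ne.symm heq))
      rw [flatSup_comm Q P] at this
      rw [this (Q ::ₘ s), this (flatSup P Q ::ₘ s)]
      ring

theorem hallRadoValue_cons_of_isMin [M.Loopless] (𝓕 : Finset (NonminFlat M))
    (f : Multiset (NonminFlat M)) {A : NonminFlat M} (hA : IsMin A)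
    (s : Multiset (NonminFlat M)) : hallRadoValue 𝓕 f (A ::ₘ s) = 0 := by
  classical
  refine Finset.prod_eq_zero (Finset.mem_univ (flagBlock 𝓕 A)) ?_
  rw [blockValue, blockPart_cons_of_eq rfl, if_neg]
  exact fun h ↦ not_dragonHallRado_cons_of_isMin _ hA _ h.2

/-- Each minor contains only copies of its top flat F, at most a F of them. The dragon condition
then follows from a F < rk F - rk (predecessor of F), the bound defining standard exponents. -/
theorem hallRadoValue_self {a : NonminFlat M →₀ ℕ} (ha : a ∈ standardExponents M) :
    hallRadoValue a.support (Finsupp.toMultiset a) (Finsupp.toMultiset a) = 1 := by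
  classical
  rw [mem_standardExponents] at ha
  refine Finset.prod_eq_one fun i _ ↦ if_pos ⟨rfl, fun t ht h0 ↦ ?_⟩
  obtain ⟨F, hF⟩ := Multiset.exists_mem_of_ne_zero h0
  have hmem : ∀ G ∈ t, G ∈ a.support ∧ flagBlock a.support G = i := fun G hG ↦ by
    have := Multiset.mem_filter.1 (Multiset.mem_of_le ht hG)
    exact ⟨by simpa using this.1, this.2⟩
  have hle : ∀ G ∈ t, ∀ H ∈ t, G ≤ H := fun G hG H hH ↦ by
    by_contra hc
    have h1 : H ∈ flagBlock a.support G := mem_flagBlock.2 ⟨(hmem H hH).1, hc⟩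
    rw [(hmem G hG).2, ← (hmem H hH).2] at h1
    exact (mem_flagBlock.1 h1).2 le_rfl
  have hrep := Multiset.eq_replicate_card.2 fun G hG ↦ le_antisymm (hle G hG F hF) (hle F hF G hG)
  have hFs := (hmem F hF).1
  have hbase : finsetUnion i = flagPred a.support F := by
    ext e
    rw [mem_flagPred, ← (hmem F hF).2]
    refine exists_congr fun G ↦ ?_
    rw [mem_flagBlock, and_assoc]
    refine and_congr_right fun hG ↦ and_congr_left fun _ ↦ ?_
    rcases ha.1.total hFs hG with h | h
    · exact ⟨fun h' ↦ absurd h h', fun h' ↦ absurd h (not_le_of_gt h')⟩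
    · exact ⟨fun h' ↦ lt_of_le_not_ge h h', fun h' ↦ not_le_of_gt h'⟩
  have hcard : t.card ≤ a F := by
    have h1 := Multiset.count_le_of_le F (ht.trans (Multiset.filter_le _ _))
    rw [hrep, Multiset.count_replicate_self, Finsupp.count_toMultiset] at h1
    exact h1
  have h2 := ha.2 F hFs
  have h3 : rk M F.1 ≤ rk M (finsetUnion i ∪ multisetUnion t) :=
    rk_mono M (fun e he ↦ Or.inr ⟨F, hF, he⟩)
  rw [hbase] at h3 ⊢
  omega

open Classical in
/-- If two multisets of flats supported on chains have the same cardinality, and each member `F`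
of the second contains equally many members of both, then the first has rank sum at most that of
the second, with equality only if they agree. -/
theorem rankSum_le_of_countP_eq (n : ℕ) {f g : Multiset (NonminFlat M)} (hf : f.card = n)
    (hg : g.card = n) (hfc : ∀ P ∈ f, ∀ Q ∈ f, P ≤ Q ∨ Q ≤ P)
    (hgc : ∀ P ∈ g, ∀ Q ∈ g, P ≤ Q ∨ Q ≤ P)
    (h : ∀ F ∈ f, g.countP (· ≤ F) = f.countP (· ≤ F)) :
    rankSum g ≤ rankSum f ∧ (rankSum f ≤ rankSum g → g = f) := by
  induction n generalizing f g with
  | zero =>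
    rw [Multiset.card_eq_zero] at hf hg
    simp [hf, hg]
  | succ n ih =>
    have hmax : ∀ s : Multiset (NonminFlat M), s.card = n + 1 →
        (∀ P ∈ s, ∀ Q ∈ s, P ≤ Q ∨ Q ≤ P) → ∃ F ∈ s, ∀ G ∈ s, G ≤ F := by
      intro s hs hc
      obtain ⟨F, hF⟩ := s.toFinset.exists_maximal (by
        rw [Multiset.toFinset_nonempty, ← Multiset.card_pos]; omega)
      have hFs := Multiset.mem_toFinset.1 hF.prop
      refine ⟨F, hFs, fun G hG ↦ ?_⟩
      rcases hc G hG F hFs with h | h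
      exacts [h, hF.le_of_ge (Multiset.mem_toFinset.2 hG) h]
    obtain ⟨F, hFf, hF⟩ := hmax f hf hfc
    obtain ⟨G, hGg, hG⟩ := hmax g hg hgc
    -- Equal counts below H reach the common cardinality simultaneously. Hence the largest member G
    -- of g lies below the largest member F of f, and removing both preserves the hypotheses.
    have hall : ∀ H ∈ f, ((∀ P ∈ g, P ≤ H) ↔ ∀ P ∈ f, P ≤ H) := fun H hH ↦ by
      rw [← Multiset.countP_eq_card (p := (· ≤ H)), ← Multiset.countP_eq_card (p := (· ≤ H)),
        h H hH, hf, hg]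
    have hGF : G ≤ F := (hall F hFf).2 hF G hGg
    have hiff : ∀ H ∈ f, (G ≤ H ↔ F ≤ H) := fun H hH ↦
      ⟨fun hGH ↦ (hall H hH).1 (fun P hP ↦ (hG P hP).trans hGH) F hFf, hGF.trans⟩
    obtain ⟨f, rfl⟩ := Multiset.exists_cons_of_mem hFf
    obtain ⟨g, rfl⟩ := Multiset.exists_cons_of_mem hGg
    rw [Multiset.card_cons, Nat.add_right_cancel_iff] at hf hg
    obtain ⟨h1, h2⟩ := ih hf hg
      (fun P hP Q hQ ↦ hfc P (Multiset.mem_cons_of_mem hP) Q (Multiset.mem_cons_of_mem hQ))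
      (fun P hP Q hQ ↦ hgc P (Multiset.mem_cons_of_mem hP) Q (Multiset.mem_cons_of_mem hQ))
      (fun H hH ↦ by
        have h3 := h H (Multiset.mem_cons_of_mem hH)
        rw [Multiset.countP_cons, Multiset.countP_cons] at h3
        simpa [hiff H (Multiset.mem_cons_of_mem hH)] using h3)
    have hrk := rk_mono M (show G.1 ⊆ F.1 from hGF)
    rw [rankSum_cons, rankSum_cons]
    refine ⟨by omega, fun hle ↦ ?_⟩
    rw [h2 (by omega), le_antisymm hGF
      (subset_of_rk_le M G.2.1 hGF F.2.1.subset_ground (by omega))]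

theorem rankSum_lt_of_hallRadoValue_ne_zero {a b : NonminFlat M →₀ ℕ}
    (ha : a ∈ standardExponents M) (hb : b ∈ standardExponents M) (hab : a ≠ b)
    (h : hallRadoValue a.support (Finsupp.toMultiset a) (Finsupp.toMultiset b) ≠ 0) :
    rankSum (Finsupp.toMultiset b) < rankSum (Finsupp.toMultiset a) := by
  classical
  have hchain : ∀ c ∈ standardExponents M, ∀ P ∈ Finsupp.toMultiset c,
      ∀ Q ∈ Finsupp.toMultiset c, P ≤ Q ∨ Q ≤ P := fun c hc P hP Q hQ ↦
    (mem_standardExponents.1 hc).1.total (by simpa using hP) (by simpa using hQ)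
  have hmap : (Finsupp.toMultiset b).map (flagBlock a.support) =
      (Finsupp.toMultiset a).map (flagBlock a.support) := by
    ext i
    have hi : blockValue a.support (Finsupp.toMultiset a) (Finsupp.toMultiset b) i ≠ 0 :=
      Finset.prod_ne_zero_iff.1 h i (Finset.mem_univ i)
    rw [blockValue, ne_eq, ite_eq_right_iff, Classical.not_imp] at hi
    simp only [Multiset.count_map, eq_comm (a := i)]
    exact hi.1.1
  obtain ⟨h1, h2⟩ := rankSum_le_of_countP_eq (f := Finsupp.toMultiset a)
    (g := Finsupp.toMultiset b) _ rfl (by simpa using congrArg Multiset.card hmap)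
    (hchain a ha) (hchain b hb) (fun F hF ↦ by
      -- For F in the support of a, a flat is contained in F exactly when F is not in its block, so
      -- block counts determine the number of members below F.
      have h3 := congrArg (Multiset.countP (F ∉ ·)) hmap
      rw [Multiset.countP_map, Multiset.countP_map, ← Multiset.countP_eq_card_filter,
        ← Multiset.countP_eq_card_filter] at h3
      have hF' : F ∈ a.support := by simpa using hF
      simpa [mem_flagBlock, Finsupp.mem_support_iff.1 hF'] using h3)
  by_contra hlt
  have := congrArg Multiset.toFinsupp (h2 (not_lt.1 hlt))
  rw [Finsupp.toMultiset_toFinsupp, Finsupp.toMultiset_toFinsupp] at this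
  exact hab this.symm

end Functional

/-! ### Linear independence and the rank of the graded pieces -/

section Independence

variable {α : Type*} {M : Matroid α} [M.Finite]

/-- The linear functional on polynomials in the `h_F` with values `hallRadoValue`. -/
noncomputable def hallRadoFunctional (𝓕 : Finset (NonminFlat M)) (f : Multiset (NonminFlat M)) :
    MvPolynomial (NonminFlat M) ℤ →ₗ[ℤ] ℤ :=
  (MvPolynomial.basisMonomials (NonminFlat M) ℤ).constr ℤ
    fun a ↦ hallRadoValue 𝓕 f (Finsupp.toMultiset a)

theorem prod_map_X_toMultiset {σ : Type*} (a : σ →₀ ℕ) :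
    ((Finsupp.toMultiset a).map (MvPolynomial.X (R := ℤ))).prod = MvPolynomial.monomial a 1 := by
  rw [MvPolynomial.monomial_eq, Finsupp.toMultiset_map, Finsupp.prod_toMultiset, map_one, one_mul,
    Finsupp.prod_mapDomain_index (by simp) (by simp [pow_add])]

theorem hallRadoFunctional_prod (𝓕 : Finset (NonminFlat M)) (f s : Multiset (NonminFlat M)) :
    hallRadoFunctional 𝓕 f (s.map MvPolynomial.X).prod = hallRadoValue 𝓕 f s := by
  classical
  have h := (MvPolynomial.basisMonomials (NonminFlat M) ℤ).constr_basis ℤ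
    (fun a ↦ hallRadoValue 𝓕 f (Finsupp.toMultiset a)) (Multiset.toFinsupp s)
  simp only [MvPolynomial.coe_basisMonomials] at h
  rw [← prod_map_X_toMultiset,
    Multiset.toFinsupp_toMultiset] at h
  exact h

/-- The largest ideal on which `hallRadoFunctional` vanishes. -/
noncomputable def hallRadoIdeal (𝓕 : Finset (NonminFlat M)) (f : Multiset (NonminFlat M)) :
    Ideal (MvPolynomial (NonminFlat M) ℤ) where
  carrier := {p | ∀ q, hallRadoFunctional 𝓕 f (q * p) = 0}
  zero_mem' := by simp
  add_mem' hp hq r := by rw [mul_add, map_add, hp r, hq r, add_zero]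
  smul_mem' c p hp q := by rw [smul_eq_mul, ← mul_assoc]; exact hp _

theorem mem_hallRadoIdeal_of_forall {𝓕 : Finset (NonminFlat M)} {f : Multiset (NonminFlat M)}
    {p : MvPolynomial (NonminFlat M) ℤ} (h : ∀ s : Multiset (NonminFlat M),
      hallRadoFunctional 𝓕 f ((s.map MvPolynomial.X).prod * p) = 0) : p ∈ hallRadoIdeal 𝓕 f := by
  intro q
  induction q using MvPolynomial.induction_on' with
  | monomial a c =>
    have h1 := h (Finsupp.toMultiset a)
    rw [prod_map_X_toMultiset] at h1
    have h2 : MvPolynomial.monomial a c = c • MvPolynomial.monomial a (1 : ℤ) := by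
      rw [MvPolynomial.smul_monomial, smul_eq_mul, mul_one]
    rw [h2, smul_mul_assoc, map_smul, h1, smul_zero]
  | add p q hp hq => rw [add_mul, map_add, hp, hq, add_zero]

theorem sub_mul_sub_mem_hallRadoIdeal {𝓕 : Finset (NonminFlat M)} (h𝓕 : IsFlag 𝓕)
    (f : Multiset (NonminFlat M)) (P Q : NonminFlat M) :
    (MvPolynomial.X P - MvPolynomial.X (flatSup P Q)) *
      (MvPolynomial.X Q - MvPolynomial.X (flatSup P Q)) ∈ hallRadoIdeal 𝓕 f := by
  refine mem_hallRadoIdeal_of_forall fun s ↦ ?_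
  have hmul : ∀ A B : NonminFlat M, (s.map (MvPolynomial.X (R := ℤ))).prod *
      (MvPolynomial.X A * MvPolynomial.X B) =
      ((A ::ₘ B ::ₘ s).map (MvPolynomial.X (R := ℤ))).prod := fun A B ↦ by
    simp only [Multiset.map_cons, Multiset.prod_cons]; ring
  rw [← hallRadoValue_exchange h𝓕 f P Q s]
  simp only [← hallRadoFunctional_prod, ← hmul, ← map_sub, ← map_add]
  congr 1
  ring

theorem X_mem_hallRadoIdeal [M.Loopless] (𝓕 : Finset (NonminFlat M))
    (f : Multiset (NonminFlat M)) {A : NonminFlat M} (hA : IsMin A) :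
    MvPolynomial.X A ∈ hallRadoIdeal 𝓕 f := by
  refine mem_hallRadoIdeal_of_forall fun s ↦ ?_
  rw [mul_comm, ← Multiset.prod_cons, ← Multiset.map_cons, hallRadoFunctional_prod,
    hallRadoValue_cons_of_isMin 𝓕 f hA]

open Classical in
-- Converse of `hElt_sub_mul_hElt_sub`, needed to recover the defining relations in the x_F. The
-- relation for P and Q expands to x_P x_Q plus products over strictly larger incomparable pairs,
-- which lie in K by descending induction on pairs.
theorem mul_mem_of_not_le {R : Type*} [CommRing R] (K : Ideal R) {h x : NonminFlat M → R}
    (hx : ∀ F, ∑ G with F ≤ G, x G = h F)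
    (hK : ∀ P Q, (h P - h (flatSup P Q)) * (h Q - h (flatSup P Q)) ∈ K) (P Q : NonminFlat M)
    (h1 : ¬ P ≤ Q) (h2 : ¬ Q ≤ P) : x P * x Q ∈ K := by
  suffices H : ∀ p : NonminFlat M × NonminFlat M, ¬ p.1 ≤ p.2 → ¬ p.2 ≤ p.1 →
    x p.1 * x p.2 ∈ K from H (P, Q) h1 h2
  clear h1 h2 P Q
  intro p
  induction p using WellFoundedGT.induction with
  | ind p ih =>
  obtain ⟨P, Q⟩ := p
  intro h1 h2
  have h3 := hK P Q
  rw [← hx P, ← hx Q, ← hx (flatSup P Q), sum_sub_sum_flatSup, flatSup_comm, sum_sub_sum_flatSup,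
    Finset.sum_mul_sum, ← Finset.sum_product',
    ← Finset.add_sum_erase (a := (P, Q)) _ _ (by simp [h1, h2])] at h3
  refine (Ideal.add_mem_iff_left K (Ideal.sum_mem K fun p hp ↦ ?_)).1 h3
  simp only [Finset.mem_erase, Finset.mem_product, Finset.mem_filter, Finset.mem_univ,
    true_and] at hp
  obtain ⟨hne, ⟨hPp, hQp⟩, hQq, hPq⟩ := hp
  exact ih p (lt_of_le_of_ne ⟨hPp, hQq⟩ (Ne.symm hne)) (fun h ↦ hPq (hPp.trans h))
    (fun h ↦ hQp (hQq.trans h))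

open Classical in
-- T is the change of variables from the x_F to the h_F, with the x_F obtained by Möbius inversion.
-- Through it every functional attached to a flag annihilates the ideal of relations.
theorem exists_algHom_cohomologyIdeal_le [M.Loopless] : ∃ T : MvPolynomial (NonminFlat M) ℤ →ₐ[ℤ]
    MvPolynomial (NonminFlat M) ℤ,
    (∀ F, T (∑ G with F ≤ G, MvPolynomial.X G) = MvPolynomial.X F) ∧
    ∀ (𝓕 : Finset (NonminFlat M)) (f : Multiset (NonminFlat M)), IsFlag 𝓕 →
      cohomologyIdeal M ≤ (hallRadoIdeal 𝓕 f).comap T := by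
  obtain ⟨x, hx⟩ := exists_sum_filter_le_eq
    (MvPolynomial.X : NonminFlat M → MvPolynomial (NonminFlat M) ℤ)
  have hT : ∀ F, MvPolynomial.aeval (R := ℤ) x (∑ G with F ≤ G, MvPolynomial.X G) =
      MvPolynomial.X F := fun F ↦ by
    rw [map_sum, ← hx F]
    exact Finset.sum_congr rfl fun G _ ↦ MvPolynomial.aeval_X _ _
  refine ⟨MvPolynomial.aeval (R := ℤ) x, hT, fun 𝓕 f h𝓕 ↦ Ideal.span_le.2 ?_⟩
  rintro _ (⟨S, hS, rfl⟩ | ⟨A, hA, rfl⟩)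
  · obtain ⟨P, hP, Q, hQ, h1, h2⟩ : ∃ P ∈ S, ∃ Q ∈ S, ¬ P ≤ Q ∧ ¬ Q ≤ P := by
      by_contra! hc
      refine hS fun P hP Q hQ _ ↦ ?_
      by_cases h : P ≤ Q
      · exact Or.inl h
      · exact Or.inr (hc P hP Q hQ h)
    rw [SetLike.mem_coe, Ideal.mem_comap, map_prod, ← Finset.mul_prod_erase _ _ hP,
      ← Finset.mul_prod_erase _ _ (Finset.mem_erase.2 ⟨by rintro rfl; exact h1 le_rfl, hQ⟩),
      ← mul_assoc, MvPolynomial.aeval_X, MvPolynomial.aeval_X]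
    exact Ideal.mul_mem_right _ _ (mul_mem_of_not_le _ hx
      (sub_mul_sub_mem_hallRadoIdeal h𝓕 f) P Q h1 h2)
  · rw [SetLike.mem_coe, Ideal.mem_comap]
    have : MvPolynomial.aeval (R := ℤ) x (∑ G with A ≤ G, MvPolynomial.X G) ∈ hallRadoIdeal 𝓕 f := by
      rw [hT]
      exact X_mem_hallRadoIdeal 𝓕 f hA
    convert this

theorem linearIndependent_hProd [M.Loopless] : LinearIndependent ℤ
    fun a : {a // a ∈ standardExponents M} ↦ hProd (Finsupp.toMultiset a.1) := by
  classical
  obtain ⟨T, hT, hI⟩ := exists_algHom_cohomologyIdeal_le (M := M)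
  rw [linearIndependent_iff']
  intro s c hc
  by_contra! hne
  -- By triangularity, the functional of a term of minimal rank sum kills all other terms of the
  -- relation and reads off the coefficient of a.
  obtain ⟨a, ha, hmin⟩ := (s.filter (c · ≠ 0)).exists_min_image
    (fun a ↦ rankSum (Finsupp.toMultiset a.1))
    (by obtain ⟨i, hi, hi0⟩ := hne; exact ⟨i, Finset.mem_filter.2 ⟨hi, hi0⟩⟩)
  obtain ⟨has, hca⟩ := Finset.mem_filter.1 ha
  set p : MvPolynomial (NonminFlat M) ℤ := ∑ b ∈ s, c b •
    ((Finsupp.toMultiset b.1).map fun F ↦ ∑ G with F ≤ G, MvPolynomial.X G).prod with hp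
  have hmk : Ideal.Quotient.mk (cohomologyIdeal M) p = 0 := by
    rw [← hc, hp, map_sum]
    refine Finset.sum_congr rfl fun b _ ↦ ?_
    rw [map_zsmul, map_multiset_prod, Multiset.map_map, hProd]
    congr 3
    ext F
    simp only [Function.comp_apply, map_sum, hElt, xElt]
  have hTp := hI a.1.support (Finsupp.toMultiset a.1) (mem_standardExponents.1 a.2).1
    (Ideal.Quotient.eq_zero_iff_mem.1 hmk) 1
  have hTp' : T p = ∑ b ∈ s, c b • ((Finsupp.toMultiset b.1).map MvPolynomial.X).prod := by
    rw [hp, map_sum]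
    refine Finset.sum_congr rfl fun b _ ↦ ?_
    rw [map_zsmul, map_multiset_prod, Multiset.map_map]
    congr 3
    ext1 F
    exact hT F
  rw [one_mul] at hTp
  change hallRadoFunctional _ _ (T p) = 0 at hTp
  rw [hTp', map_sum, Finset.sum_eq_single a] at hTp
  · rw [map_zsmul, hallRadoFunctional_prod, hallRadoValue_self a.2] at hTp
    exact hca (by simpa using hTp)
  · intro b hb hba
    rw [map_zsmul, hallRadoFunctional_prod]
    by_cases hcb : c b = 0
    · rw [hcb, zero_smul]
    · by_cases h0 : hallRadoValue a.1.support (Finsupp.toMultiset a.1) (Finsupp.toMultiset b.1) = 0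
      · rw [h0, smul_zero]
      · have h1 := rankSum_lt_of_hallRadoValue_ne_zero a.2 b.2
          (fun h ↦ hba (Subtype.ext h.symm)) h0
        exact absurd (hmin b (Finset.mem_filter.2 ⟨hb, hcb⟩)) (not_le_of_gt h1)
  · exact fun h ↦ absurd has h

theorem finrank_cohomologyPiece_two_mul [M.Loopless] (n : ℕ) :
    Module.finrank ℤ (cohomologyPiece M (2 * n)) =
      ((standardExponents M).filter (·.degree = n)).card := by
  have hli := (linearIndependent_hProd (M := M)).comp
    (fun a : {a // a ∈ (standardExponents M).filter (·.degree = n)} ↦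
      (⟨a.1, (Finset.mem_filter.1 a.2).1⟩ : {a // a ∈ standardExponents M}))
    (fun a b h ↦ Subtype.ext
      (congrArg (fun x : {a // a ∈ standardExponents M} ↦ x.1) h))
  have hrange : standardMonomials M n = Set.range ((fun a : {a // a ∈ standardExponents M} ↦
      hProd (Finsupp.toMultiset a.1)) ∘
      fun a : {a // a ∈ (standardExponents M).filter (·.degree = n)} ↦
      (⟨a.1, (Finset.mem_filter.1 a.2).1⟩ : {a // a ∈ standardExponents M})) := by
    ext y
    constructor
    · rintro ⟨a, ha, hn, rfl⟩
      exact ⟨⟨a, Finset.mem_filter.2 ⟨ha, hn⟩⟩, rfl⟩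
    · rintro ⟨a, rfl⟩
      exact ⟨a.1, (Finset.mem_filter.1 a.2).1, (Finset.mem_filter.1 a.2).2, rfl⟩
  rw [cohomologyPiece_two_mul, hrange, finrank_span_eq_card hli, Fintype.card_coe]

end Independence

end MatroidHilbert

theorem mainTheorem3 {α : Type*} (M : Matroid α) [M.Finite] [M.Nonempty] [M.Loopless] :
    (∀ 𝓕 ∈ MatroidHilbert.properFlags M,
      (X - 1) ^ 𝓕.card ∣ MatroidHilbert.reducedCharPoly (MatroidHilbert.flagMatroid M 𝓕)) ∧
    (((MatroidHilbert.poincarePoly M).comp (X ^ 2) : ℤ[X]) : PowerSeries ℤ) =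
      PowerSeries.mk fun i : ℕ ↦
        (Module.finrank ℤ (MatroidHilbert.cohomologyPiece M i) : ℤ) := by
  classical
  refine ⟨fun 𝓕 h𝓕 ↦ MatroidHilbert.X_sub_one_pow_dvd_reducedCharPoly h𝓕, ?_⟩
  ext i
  rw [PowerSeries.coeff_mk, Polynomial.coeff_coe, ← Polynomial.expand_eq_comp_X_pow,
    Polynomial.coeff_expand (by norm_num)]
  split_ifs with hi
  · obtain ⟨n, rfl⟩ := hi
    rw [Nat.mul_div_cancel_left n (by norm_num), MatroidHilbert.finrank_cohomologyPiece_two_mul,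
      MatroidHilbert.poincarePoly_eq_sum_standardExponents, Polynomial.finsetSum_coeff]
    simp only [Polynomial.coeff_X_pow, Finset.sum_boole, eq_comm (a := n)]
  · rw [MatroidHilbert.cohomologyPiece_odd hi, finrank_bot, Nat.cast_zero]
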